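/- \textbf{Theorem (Reeb stability).} A metric space is \emph{geodesic} if any two points $x,x'$ are joined by an isometrically embedded interval of length $d(x,x')$. For a compact geodesic space $X$ and $p\in X$, let $X_p=X/\!\sim$ be the Reeb graph of $d(p,\cdot):X\to\mathbb R$, with the quotient topology, where $x\sim x'$ if there is a continuous path from $x$ to $x'$ along which $d(p,\cdot)$ is constant. The space $X_p$ carries the distance $$d_p([x],[x'])=\inf\{\mathrm L_{\mathbb R}(d(p,\cdot)\circ\gamma):\gamma\text{ a continuous path from }x\text{ to }x'\text{ in }X\},$$ where $\mathrm L_{\mathbb R}$ denotes length (total variation). A \emph{finite graph} is a Hausdorff space with a finite CW structure of dimension at most $1$, and $\beta_1$ denotes the first Betti number $\dim H_1(\,\cdot\,;\mathbb R)$. A correspondence between $X$ and $Y$ is a relation $R\subseteq X\times Y$ that projects onto $X$ and onto $Y$; its distortion is $\mathrm{dis}(R)=\sup\{|d(x,x')-d(y,y')|: x\,R\,y,\ x'\,R\,y'\}$, and $d_{\mathrm{GH}}(X,Y)=\tfrac12\inf_R\mathrm{dis}(R)$ over all correspondences $R$. A \emph{path correspondence} between $(X,p)$ and $(Y,q)$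 is a correspondence $R$ that contains a correspondence $R_0$ with $p\,R_0\,q$ and the following property: whenever $x\,R_0\,y$ and $x'\,R_0\,y'$, and $\alpha:[0,1]\to X$ is a continuous path from $x$ to $x'$ and $\beta:[0,1]\to Y$ a continuous path from $y$ to $y'$, there are continuous paths $\tilde\alpha:[0,1]\to X$ from $x$ to $x'$ and $\tilde\beta:[0,1]\to Y$ from $y$ to $y'$ with $\alpha(t)\,R\,\tilde\beta(t)$ and $\tilde\alpha(t)\,R\,\beta(t)$ for all $t$. Let $$d^{\ell}_{\mathrm{GH}}\big((X,p),(Y,q)\big)=\tfrac12\inf\{\mathrm{dis}(R): R\text{ a path correspondence between }(X,p)\text{ and }(Y,q)\}.$$ Let $X,Y$ be compact geodesic spaces and $p\in X$, $q\in Y$ points such that $X_p$ and $Y_q$ are finite graphs, and let $\beta=\max(\beta_1(X_p),\beta_1(Y_q))$. Then $$d_{\mathrm{GH}}\big((X_p,d_p),(Y_q,d_q)\big)\le(8\beta+6)\,d^{\ell}_{\mathrm{GH}}\big((X,p),(Y,q)\big).$$ -/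

import Mathlib

open scoped ENNReal unitInterval

universe u v

/-- A geodesic space: any two points `x`, `y` are joined by a length minimizing geodesic, i.e. an
isometric embedding of the interval `[0, d(x, y)]` that starts at `x` and ends at `y`. -/
class GeodesicSpace (X : Type u) [PseudoMetricSpace X] : Prop where
  exists_geodesic : ∀ x y : X, ∃ γ : ℝ → X, γ 0 = x ∧ γ (dist x y) = y ∧
    ∀ s ∈ Set.Icc 0 (dist x y), ∀ t ∈ Set.Icc 0 (dist x y), dist (γ s) (γ t) = |s - t|

section Reeb

variable {X : Type u} [TopologicalSpace X]

/-- The Reeb relation of `f`: two points are equivalent if they are joined by a continuous path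
along which `f` is constant. -/
def reebSetoid (f : X → ℝ) : Setoid X where
  r x x' := ∃ γ : Path x x', ∀ t, f (γ t) = f x
  iseqv :=
    { refl := fun x => ⟨Path.refl x, fun _ => rfl⟩
      symm := by
        rintro x y ⟨γ, hγ⟩
        have h1 : f y = f x := by simpa using hγ 1
        exact ⟨γ.symm, fun t => by rw [h1]; exact hγ _⟩
      trans := by
        rintro x y z ⟨γ, hγ⟩ ⟨δ, hδ⟩
        have h1 : f y = f x := by simpa using hγ 1
        refine ⟨γ.trans δ, fun t => ?_⟩
        rw [Path.trans_apply]
        split_ifs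
        · exact hγ _
        · rw [hδ, h1] }

/-- The length `L_ℝ(f ∘ γ)` of the real path `f ∘ γ`, i.e. its total variation. -/
noncomputable def lengthAlong (f : X → ℝ) {x y : X} (γ : Path x y) : ℝ≥0∞ :=
  eVariationOn (fun t : I => f (γ t)) Set.univ

/-- The infimum of `L_ℝ(f ∘ γ)` over all continuous paths `γ` from `x` to `y`. -/
noncomputable def reebEDist (f : X → ℝ) (x y : X) : ℝ≥0∞ :=
  ⨅ γ : Path x y, lengthAlong f γ

lemma lengthAlong_symm_le (f : X → ℝ) {x y : X} (γ : Path x y) :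
    lengthAlong f γ.symm ≤ lengthAlong f γ := by
  have h := eVariationOn.comp_le_of_antitoneOn (fun t : I => f (γ t)) (s := Set.univ)
    (t := Set.univ) unitInterval.symm (fun a _ b _ hab => unitInterval.symm_le_symm.2 hab)
    (fun _ _ => Set.mem_univ _)
  exact h

lemma lengthAlong_trans_le (f : X → ℝ) {x y z : X} (γ : Path x y) (δ : Path y z) :
    lengthAlong f (γ.trans δ) ≤ lengthAlong f γ + lengthAlong f δ := by
  let h : I := ⟨1 / 2, by norm_num, by norm_num⟩
  have hs : IsGreatest (Set.Iic h) h := ⟨le_refl h, fun _ hx => hx⟩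
  have ht : IsLeast (Set.Ici h) h := ⟨le_refl h, fun _ hx => hx⟩
  have hu := eVariationOn.union (fun t : I => f ((γ.trans δ) t)) hs ht
  rw [Set.Iic_union_Ici] at hu
  rw [lengthAlong, hu]
  refine add_le_add ?_ ?_
  · have hmono : MonotoneOn (fun t : I => Set.projIcc (0 : ℝ) 1 zero_le_one (2 * (t : ℝ)))
        (Set.Iic h) := fun a _ b _ hab =>
      Set.monotone_projIcc _ (by have : (a : ℝ) ≤ b := hab; linarith)
    have hle := eVariationOn.comp_le_of_monotoneOn (fun t : I => f (γ t)) (s := Set.univ) (t := Set.Iic h) _ hmono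
      (fun _ _ => Set.mem_univ _)
    refine le_trans (le_of_eq (eVariationOn.congr ?_)) hle
    intro t ht'
    have ht2 : (t : ℝ) ≤ 1 / 2 := ht'
    simp only [Function.comp_apply, Path.trans_apply, dif_pos ht2]
    rw [Set.projIcc_of_mem zero_le_one (⟨by have := t.2.1; linarith, by linarith⟩ :
      2 * (t : ℝ) ∈ Set.Icc (0 : ℝ) 1)]
  · have hmono : MonotoneOn (fun t : I => Set.projIcc (0 : ℝ) 1 zero_le_one (2 * (t : ℝ) - 1))
        (Set.Ici h) := fun a _ b _ hab =>
      Set.monotone_projIcc _ (by have : (a : ℝ) ≤ b := hab; linarith)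
    have hle := eVariationOn.comp_le_of_monotoneOn (fun t : I => f (δ t)) (s := Set.univ) (t := Set.Ici h) _ hmono
      (fun _ _ => Set.mem_univ _)
    refine le_trans (le_of_eq (eVariationOn.congr ?_)) hle
    intro t ht'
    have ht2 : 1 / 2 ≤ (t : ℝ) := ht'
    have ht1 : (t : ℝ) ≤ 1 := t.2.2
    simp only [Function.comp_apply]
    rw [Set.projIcc_of_mem zero_le_one (⟨by linarith, by linarith⟩ :
      2 * (t : ℝ) - 1 ∈ Set.Icc (0 : ℝ) 1), Path.trans_apply]
    split_ifs with hc
    · have he : (t : ℝ) = 1 / 2 := le_antisymm hc ht2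
      have e1 : (⟨2 * (t : ℝ), (unitInterval.mul_pos_mem_iff zero_lt_two).2 ⟨t.2.1, hc⟩⟩ : I) = 1 :=
        Subtype.ext (by simp [he])
      have e2 : (⟨2 * (t : ℝ) - 1, ⟨by linarith, by linarith⟩⟩ : I) = 0 :=
        Subtype.ext (by simp [he])
      rw [e1, e2]; simp
    · rfl

lemma reebEDist_self (f : X → ℝ) (x : X) : reebEDist f x x = 0 := by
  refine le_antisymm (iInf_le_of_le (Path.refl x) (le_of_eq ?_)) (zero_le)
  rw [lengthAlong, eVariationOn.eq_zero_iff]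
  simp

lemma reebEDist_comm (f : X → ℝ) (x y : X) : reebEDist f x y = reebEDist f y x :=
  le_antisymm
    (le_iInf fun γ => iInf_le_of_le γ.symm (lengthAlong_symm_le f γ))
    (le_iInf fun γ => iInf_le_of_le γ.symm (lengthAlong_symm_le f γ))

lemma reebEDist_triangle (f : X → ℝ) (x y z : X) :
    reebEDist f x z ≤ reebEDist f x y + reebEDist f y z := by
  unfold reebEDist
  rw [ENNReal.iInf_add]
  refine le_iInf fun γ => ?_
  rw [ENNReal.add_iInf]
  exact le_iInf fun δ => iInf_le_of_le (γ.trans δ) (lengthAlong_trans_le f γ δ)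

lemma reebEDist_eq_zero_of_rel (f : X → ℝ) {x y : X} (h : (reebSetoid f) x y) :
    reebEDist f x y = 0 := by
  obtain ⟨γ, hγ⟩ := h
  refine le_antisymm (iInf_le_of_le γ (le_of_eq ?_)) (zero_le)
  rw [lengthAlong, eVariationOn.eq_zero_iff]
  intro s _ t _
  simp [hγ]

lemma reebEDist_congr (f : X → ℝ) {x y x' y' : X} (hx : (reebSetoid f) x x')
    (hy : (reebSetoid f) y y') : reebEDist f x y = reebEDist f x' y' := by
  have hx0 := reebEDist_eq_zero_of_rel f hx
  have hy0 := reebEDist_eq_zero_of_rel f hy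
  refine le_antisymm ?_ ?_
  · calc reebEDist f x y ≤ reebEDist f x x' + (reebEDist f x' y' + reebEDist f y' y) :=
          (reebEDist_triangle f x x' y).trans (add_le_add le_rfl (reebEDist_triangle f x' y' y))
      _ = reebEDist f x' y' := by rw [hx0, reebEDist_comm f y' y, hy0, zero_add, add_zero]
  · calc reebEDist f x' y' ≤ reebEDist f x' x + (reebEDist f x y + reebEDist f y y') :=
          (reebEDist_triangle f x' x y').trans (add_le_add le_rfl (reebEDist_triangle f x y y'))
      _ = reebEDist f x y := by rw [hy0, reebEDist_comm f x' x, hx0, zero_add, add_zero]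

end Reeb

/-- The Reeb graph `X_p` of the function `d(p, ·)`, as a topological space with the quotient
topology. -/
abbrev ReebGraph {X : Type u} [PseudoMetricSpace X] (p : X) : Type u :=
  Quotient (reebSetoid (fun x : X => dist p x))

/-- The points of the Reeb graph `X_p`, to be endowed with the distance `d_p`. -/
def ReebMetricGraph {X : Type u} [PseudoMetricSpace X] (p : X) : Type u :=
  ReebGraph p

lemma reebEDist_ne_top {X : Type u} [PseudoMetricSpace X] [GeodesicSpace X] (p x y : X) :
    reebEDist (fun z : X => dist p z) x y ≠ ⊤ := by
  obtain ⟨γ, h0, h1, hγ⟩ := GeodesicSpace.exists_geodesic x y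
  have hd : (0 : ℝ) ≤ dist x y := dist_nonneg
  have hmem : ∀ t : I, (t : ℝ) * dist x y ∈ Set.Icc 0 (dist x y) := fun t =>
    ⟨mul_nonneg t.2.1 hd, mul_le_of_le_one_left hd t.2.2⟩
  have hdist : ∀ s t : I, dist (γ ((s : ℝ) * dist x y)) (γ ((t : ℝ) * dist x y))
      = dist x y * dist s t := by
    intro s t
    rw [hγ _ (hmem s) _ (hmem t), ← sub_mul, abs_mul, abs_of_nonneg hd, Subtype.dist_eq,
      Real.dist_eq, mul_comm]
  have hlip : LipschitzWith (Real.toNNReal (dist x y)) (fun t : I => γ ((t : ℝ) * dist x y)) :=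
    LipschitzWith.of_dist_le_mul fun s t => by rw [hdist, Real.coe_toNNReal _ hd]
  let δ : Path x y :=
    { toFun := fun t => γ ((t : ℝ) * dist x y)
      continuous_toFun := hlip.continuous
      source' := by simp [h0]
      target' := by simp [h1] }
  refine ne_top_of_le_ne_top ?_ (iInf_le _ δ)
  have hlip2 : LipschitzWith (1 * Real.toNNReal (dist x y)) (fun t : I => dist p (δ t)) :=
    (LipschitzWith.dist_right p).comp hlip
  have hle : lengthAlong (fun z : X => dist p z) δ
      ≤ ((1 * Real.toNNReal (dist x y) : NNReal) : ℝ≥0∞)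
        * eVariationOn (fun t : I => (t : ℝ)) Set.univ := by
    rw [lengthAlong, eVariationOn]
    refine iSup_le fun q => ?_
    refine le_trans (Finset.sum_le_sum (g := fun i => ((1 * Real.toNNReal (dist x y) : NNReal) :
      ℝ≥0∞) * edist ((q.2.1 (i + 1) : I) : ℝ) ((q.2.1 i : I) : ℝ)) fun i _ => hlip2 _ _) ?_
    rw [← Finset.mul_sum]
    exact mul_le_mul_right (eVariationOn.sum_le q.2.2.1 q.2.2.2) _
  refine ne_top_of_le_ne_top (ENNReal.mul_ne_top ENNReal.coe_ne_top ?_) hle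
  have h2 := MonotoneOn.eVariationOn_eq (f := fun t : I => (t : ℝ)) (s := Set.univ)
    (a := 0) (b := 1) (fun a _ b _ hab => hab) (Set.mem_univ _) (Set.mem_univ _)
  have h3 : (Set.univ ∩ Set.Icc (0 : I) 1) = Set.univ := by
    ext t; simp [unitInterval.le_one']
  rw [h3] at h2
  rw [h2]; exact ENNReal.ofReal_ne_top

/-- The distance `d_p([x], [x']) = inf {L_ℝ(d(p, ·) ∘ γ) : γ a continuous path from x to x'}` on
the Reeb graph of a geodesic space. It separates the points as soon as the Reeb graph is a finite
graph. -/
noncomputable instance ReebMetricGraph.instPseudoMetricSpace {X : Type u} [PseudoMetricSpace X] [GeodesicSpace X] (p : X) : PseudoMetricSpace (ReebMetricGraph p) where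
  dist a b := Quotient.liftOn₂ a b (fun x y => (reebEDist (fun z : X => dist p z) x y).toReal)
    (fun _ _ _ _ hx hy => congrArg ENNReal.toReal (reebEDist_congr _ hx hy))
  dist_self a := by
    induction a using Quotient.inductionOn with
    | _ x => exact congrArg ENNReal.toReal (reebEDist_self _ x)
  dist_comm a b := by
    induction a, b using Quotient.inductionOn₂ with
    | _ x y => exact congrArg ENNReal.toReal (reebEDist_comm _ x y)
  dist_triangle a b c := by
    induction a, b, c using Quotient.inductionOn₃ with
    | _ x y z =>
      exact (ENNReal.toReal_mono (ENNReal.add_ne_top.2 ⟨reebEDist_ne_top p x y,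
        reebEDist_ne_top p y z⟩) (reebEDist_triangle _ x y z)).trans ENNReal.toReal_add_le

/-- A finite topological graph (loops and multiple edges are allowed): a Hausdorff space with a
finite CW structure all of whose cells have dimension at most one. -/
def IsFiniteTopologicalGraph (G : Type u) [TopologicalSpace G] : Prop :=
  T2Space G ∧ ∃ _ : Topology.CWComplex (Set.univ : Set G),
    Topology.RelCWComplex.Finite (Set.univ : Set G) ∧
      ∀ n : ℕ, 2 ≤ n → IsEmpty (Topology.CWComplex.cell (Set.univ : Set G) n)

/-- The first Betti number: the dimension of the first singular homology with real coefficients. -/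
noncomputable def firstBettiNumber (G : Type u) [TopologicalSpace G] : ℕ∞ :=
  Cardinal.toENat (Module.rank ℝ
    (((AlgebraicTopology.singularHomologyFunctor (ModuleCat.{u} ℝ) 1).obj
      (ModuleCat.of ℝ (ULift.{u} ℝ))).obj (TopCat.of G)))

section GromovHausdorff

/-- A correspondence between two sets: a relation that is total on both sides. -/
def IsCorrespondence {X : Type u} {Y : Type v} (R : X → Y → Prop) : Prop :=
  (∀ x, ∃ y, R x y) ∧ ∀ y, ∃ x, R x y

/-- `R₀` is a subcorrespondence of `R`. -/
def IsSubcorrespondence {X : Type u} {Y : Type v} (R₀ R : X → Y → Prop) : Prop :=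
  IsCorrespondence R₀ ∧ ∀ x y, R₀ x y → R x y

/-- `R₀` is a path subcorrespondence of `R`. -/
def IsPathSubcorrespondence {X : Type u} {Y : Type v} [TopologicalSpace X] [TopologicalSpace Y]
    (R₀ R : X → Y → Prop) : Prop :=
  IsSubcorrespondence R₀ R ∧
    ∀ (x x' : X) (y y' : Y), R₀ x y → R₀ x' y' → ∀ (α : Path x x') (β : Path y y'),
      ∃ (α' : Path x x') (β' : Path y y'), (∀ t, R (α t) (β' t)) ∧ ∀ t, R (α' t) (β t)

/-- `R` is a path correspondence between the pointed spaces `(X, p)` and `(Y, q)`. -/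
def IsPointedPathCorrespondence {X : Type u} {Y : Type v} [TopologicalSpace X]
    [TopologicalSpace Y] (p : X) (q : Y) (R : X → Y → Prop) : Prop :=
  IsCorrespondence R ∧ ∃ R₀ : X → Y → Prop, IsPathSubcorrespondence R₀ R ∧ R₀ p q

variable {X : Type u} {Y : Type v} [PseudoMetricSpace X] [PseudoMetricSpace Y]

/-- The metric distortion `sup |d(x, x') - d(y, y')|` over all `x R y` and `x' R y'`. -/
noncomputable def distortion (R : X → Y → Prop) : ℝ≥0∞ :=
  ⨆ (x : X) (y : Y) (_ : R x y) (x' : X) (y' : Y) (_ : R x' y'),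
    ENNReal.ofReal |dist x x' - dist y y'|

/-- The Gromov-Hausdorff distance: half the infimum of the distortions of all correspondences. -/
noncomputable def gromovHausdorffDist (X : Type u) (Y : Type v) [PseudoMetricSpace X]
    [PseudoMetricSpace Y] : ℝ≥0∞ :=
  (⨅ (R : X → Y → Prop) (_ : IsCorrespondence R), distortion R) / 2

/-- The pointed length Gromov-Hausdorff distance: half the infimum of the distortions of all path
correspondences between `(X, p)` and `(Y, q)`. -/
noncomputable def lengthGromovHausdorffDist (p : X) (q : Y) : ℝ≥0∞ :=
  (⨅ (R : X → Y → Prop) (_ : IsPointedPathCorrespondence p q R), distortion R) / 2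

end GromovHausdorff

/-! The two Reeb distances are compared along corresponding paths. Since `p` and `q` correspond, the
functions `d(p, ·)` and `d(q, ·)` differ by at most `ε = dis R` on corresponding points. A nearly
minimal path `α` in `X` therefore has a partner `β` in `Y` whose height `d(q, β)` is `ε`-close to
the function `d(p, α)`, whose variation is almost `d_p`. The height along `β` may oscillate wildly
within this tolerance, so its variation says nothing; what must be bounded is the distance in `Y_q`
between the ends of `β`.

Every point of a Reeb graph descends to the root at unit speed. Call a point regular if each descent
from it can be followed from all nearby points. Along a stretch of path with regular interior, the
lowest point lies on descents from both ends, so the distance of the ends is at most the sum of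
their heights minus twice the minimum: oscillations cost only `4ε` per stretch
(`exists_dist_le_of_regular`, `dist_le_of_regular`). Cutting out everything between the first and
the last visit of each irregular point leaves at most `k + 1` stretches, where `k` is the number of
irregular points, so the total error is `4 (k + 1) ε` (`dist_le_of_path`).

It remains to show `k ≤ β₁`. The graph is cut into arcs parametrized by height, and an irregular
point is a fork, a vertex from which two arcs descend (`isRegularPoint`,
`mem_forks_of_not_isRegularPoint`). Descending to the root along the one and the other arc gives a
loop at each fork. The circle valued map that collapses the complement of the first arc has degree
one on this loop and degree zero on the loop of any other fork that is not higher, so the loops are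
independent in homology (`card_forks_le`).

Altogether `|d_p - d_q| ≤ (4β + 4) dis R` on the image of `R₀`, which is stronger than what is
claimed. -/

/-! ### Lower bounds for the first Betti number from circle valued maps -/

section Homology

open CategoryTheory Simplicial

/-- A family of vectors is linearly independent if it pairs triangularly, with respect to a height
function, with a family of linear forms. -/
lemma linearIndependent_of_triangular_pairing {ι M : Type*} [AddCommGroup M] [Module ℝ M]
    (h : ι → ℝ) (z : ι → M) (φ : ι → M →ₗ[ℝ] ℝ)
    (hdiag : ∀ i, φ i (z i) ≠ 0) (hoff : ∀ i j, j ≠ i → h j ≤ h i → φ i (z j) = 0) :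
    LinearIndependent ℝ z := by
  classical
  rw [linearIndependent_iff']
  intro s c hsum
  by_contra! hne
  obtain ⟨i₀, hi₀, hci₀⟩ := hne
  -- Among the indices with nonzero coefficient take one of maximal height: its form annihilates all
  -- other terms of the relation.
  obtain ⟨i, hi, hmax⟩ := (s.filter fun i => c i ≠ 0).exists_max_image h
    ⟨i₀, Finset.mem_filter.2 ⟨hi₀, hci₀⟩⟩
  rw [Finset.mem_filter] at hi
  have h1 := congrArg (φ i) hsum
  rw [map_sum, map_zero, Finset.sum_eq_single i] at h1
  · rw [map_smul, smul_eq_mul] at h1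
    exact (mul_ne_zero hi.2 (hdiag i)) h1
  · intro j hj hji
    by_cases hcj : c j = 0
    · simp [hcj]
    · rw [map_smul, hoff i j hji (hmax j (Finset.mem_filter.2 ⟨hj, hcj⟩)), smul_zero]
  · exact fun hni => absurd hi.1 hni

section SimplicialCocycle

variable (S : SSet.{u})

/-- The coefficient module of real homology. -/
abbrev realCoeff : ModuleCat.{u} ℝ := ModuleCat.of ℝ (ULift.{u} ℝ)

/-- The linear form on simplicial `1`-chains with the values `φ` on the simplices. -/
noncomputable def cochainHom (φ : S _⦋1⦌ → ℝ) : (S.chainComplex realCoeff).X 1 ⟶ realCoeff.{u} :=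
  Limits.Sigma.desc fun x => φ x • 𝟙 realCoeff

lemma ι_cochainHom (φ : S _⦋1⦌ → ℝ) (x : S _⦋1⦌) :
    S.ιChainComplex x ≫ cochainHom S φ = φ x • 𝟙 realCoeff :=
  Limits.Sigma.ι_desc _ _

lemma d_cochainHom (φ : S _⦋1⦌ → ℝ)
    (hφ : ∀ x : S _⦋2⦌, φ (S.δ 0 x) - φ (S.δ 1 x) + φ (S.δ 2 x) = 0) :
    (S.chainComplex realCoeff).d 2 1 ≫ cochainHom S φ = 0 := by
  apply SSet.chainComplex_hom_ext
  intro x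
  rw [← Category.assoc, SSet.ιChainComplex_d, Fin.sum_univ_three]
  simp only [Preadditive.add_comp, Linear.smul_comp, ι_cochainHom, Limits.comp_zero]
  have : (φ (S.δ 0 x) - φ (S.δ 1 x) + φ (S.δ 2 x)) • 𝟙 realCoeff.{u} = 0 := by
    rw [hφ, zero_smul]
  rw [← this]
  simp [add_smul, sub_smul]
  abel

lemma sub_ι_d (a b : S _⦋1⦌) (h0 : S.δ 0 a = S.δ 0 b) (h1 : S.δ 1 a = S.δ 1 b) :
    (S.ιChainComplex a - S.ιChainComplex b : realCoeff.{u} ⟶ (S.chainComplex realCoeff.{u}).X 1) ≫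
      (S.chainComplex realCoeff.{u}).d 1 0 = 0 := by
  rw [Preadditive.sub_comp, SSet.ιChainComplex_d, SSet.ιChainComplex_d, Fin.sum_univ_two,
    Fin.sum_univ_two, h0, h1, sub_self]

/-- A lower bound for the first Betti number of a simplicial set: cocycles that pair triangularly
with differences of parallel edges. -/
lemma le_rank_homology_one_of_triangular {ι : Type*} (h : ι → ℝ)
    (a b : ι → S _⦋1⦌) (h0 : ∀ i, S.δ 0 (a i) = S.δ 0 (b i))
    (h1 : ∀ i, S.δ 1 (a i) = S.δ 1 (b i)) (φ : ι → S _⦋1⦌ → ℝ)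
    (hφ : ∀ i, ∀ x : S _⦋2⦌, φ i (S.δ 0 x) - φ i (S.δ 1 x) + φ i (S.δ 2 x) = 0)
    (hdiag : ∀ i, φ i (a i) - φ i (b i) ≠ 0)
    (hoff : ∀ i j, j ≠ i → h j ≤ h i → φ i (a j) - φ i (b j) = 0) :
    ENat.card ι ≤ Cardinal.toENat (Module.rank ℝ ((S.chainComplex realCoeff.{u}).homology 1)) := by
  let K := S.chainComplex (realCoeff.{u})
  -- Homology classes are handled as morphisms from the coefficient object and linear forms as
  -- morphisms to it; evaluation at `1` turns them into vectors and functionals.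
  let Z : ι → ((realCoeff.{u}) ⟶ K.homology 1) := fun i =>
    K.liftCycles (S.ιChainComplex (a i) - S.ιChainComplex (b i)) 0 (by simp)
      (sub_ι_d S _ _ (h0 i) (h1 i)) ≫ K.homologyπ 1
  let Φ : ι → (K.homology 1 ⟶ (realCoeff.{u})) := fun i =>
    K.homologyι 1 ≫ K.descOpcycles (cochainHom S (φ i)) 2 (by simp) (d_cochainHom S _ (hφ i))
  have hZΦ : ∀ i j, Z j ≫ Φ i = (φ i (a j) - φ i (b j)) • 𝟙 realCoeff.{u} := by
    intro i j
    simp only [Z, Φ, Category.assoc, HomologicalComplex.homology_π_ι_assoc,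
      HomologicalComplex.p_descOpcycles, HomologicalComplex.liftCycles_i_assoc]
    rw [Preadditive.sub_comp, ι_cochainHom, ι_cochainHom, sub_smul]
  let z : ι → K.homology 1 := fun i => (Z i).hom (ULift.up 1)
  let ψ : ι → K.homology 1 →ₗ[ℝ] ℝ := fun i =>
    (ULift.moduleEquiv : ULift.{u} ℝ ≃ₗ[ℝ] ℝ).toLinearMap ∘ₗ (Φ i).hom
  have hψ : ∀ i j, ψ i (z j) = φ i (a j) - φ i (b j) := by
    intro i j
    have := congrArg (fun f => ULift.down (ModuleCat.Hom.hom f (ULift.up (1 : ℝ)))) (hZΦ i j)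
    simpa [ψ, z] using this
  have hli : LinearIndependent ℝ z := linearIndependent_of_triangular_pairing h z ψ
    (fun i => by rw [hψ]; exact hdiag i) (fun i j hji hle => by rw [hψ]; exact hoff i j hji hle)
  have := hli.cardinal_lift_le_rank
  have h2 := Cardinal.toENat.monotone' this
  simpa [ENat.card] using h2

end SimplicialCocycle

section CircleCocycle

variable {G : Type u} [TopologicalSpace G]

lemma exists_lift_addCircle {A : Type*} [TopologicalSpace A] [SimplyConnectedSpace A]
    [LocallyPathConnectedSpace A] (F : C(A, AddCircle (1 : ℝ))) :
    ∃ L : C(A, ℝ), ∀ a, ((L a : ℝ) : AddCircle (1 : ℝ)) = F a := by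
  obtain ⟨a₀⟩ : Nonempty A := inferInstance
  obtain ⟨e, he⟩ := QuotientAddGroup.mk_surjective (F a₀)
  obtain ⟨L, ⟨-, hL⟩, -⟩ := (AddCircle.isCoveringMap_coe (1 : ℝ)).existsUnique_continuousMap_lifts
    F a₀ e he
  exact ⟨L, fun a => congrFun hL a⟩

/-- Two lifts differ by a continuous function that becomes constant in the circle, hence is constant
itself. So the change of a lift does not depend on the lift. -/
lemma lift_addCircle_sub_eq {A : Type*} [TopologicalSpace A] [PreconnectedSpace A]
    (L L' : C(A, ℝ)) (h : ∀ a, ((L a : ℝ) : AddCircle (1 : ℝ)) = (L' a : ℝ)) (a b : A) :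
    L a - L b = L' a - L' b := by
  have := (AddCircle.isCoveringMap_coe (1 : ℝ)).const_of_comp (g := fun x => L x - L' x)
    (by fun_prop) (fun x y => by
      simp only [AddCircle.coe_sub, h, sub_self]) a b
  linarith

instance stdSimplex_simplyConnectedSpace (n : ℕ) :
    SimplyConnectedSpace (stdSimplex ℝ (Fin (n + 1))) := by
  have : ContractibleSpace (stdSimplex ℝ (Fin (n + 1))) :=
    (convex_stdSimplex ℝ (Fin (n + 1))).contractibleSpace ⟨_, single_mem_stdSimplex ℝ 0⟩
  infer_instance

instance stdSimplex_locallyPathConnectedSpace (n : ℕ) :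
    LocallyPathConnectedSpace (stdSimplex ℝ (Fin (n + 1))) :=
  (convex_stdSimplex ℝ (Fin (n + 1))).locallyPathConnectedSpace

/-- The change of a lift of the circle valued map `f` along a singular `1`-simplex. -/
noncomputable def circleCochain (f : C(G, AddCircle (1 : ℝ))) (c : C(stdSimplex ℝ (Fin 2), G)) :
    ℝ :=
  (exists_lift_addCircle (f.comp c)).choose (stdSimplex.vertex 1) -
    (exists_lift_addCircle (f.comp c)).choose (stdSimplex.vertex 0)

lemma circleCochain_eq (f : C(G, AddCircle (1 : ℝ))) (c : C(stdSimplex ℝ (Fin 2), G))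
    (L : C(stdSimplex ℝ (Fin 2), ℝ)) (hL : ∀ a, ((L a : ℝ) : AddCircle (1 : ℝ)) = f (c a)) :
    circleCochain f c = L (stdSimplex.vertex 1) - L (stdSimplex.vertex 0) :=
  lift_addCircle_sub_eq _ _
    (fun a => ((exists_lift_addCircle (f.comp c)).choose_spec a).trans (hL a).symm) _ _

lemma toSSetObjEquiv_δ {n : ℕ} (i : Fin (n + 2)) (x : (TopCat.toSSet.obj (TopCat.of G)) _⦋n + 1⦌) :
    TopCat.toSSetObjEquiv (TopCat.of G) (.op ⦋n⦌) ((TopCat.toSSet.obj (TopCat.of G)).δ i x) =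
      (TopCat.toSSetObjEquiv (TopCat.of G) (.op ⦋n + 1⦌) x).comp
        ⟨stdSimplex.map i.succAbove, stdSimplex.continuous_map _⟩ := by
  rfl

/-- A lift over the whole `2`-simplex restricts to lifts over its faces, and the alternating sum of
its vertex differences telescopes. -/
lemma circleCochain_cocycle (f : C(G, AddCircle (1 : ℝ)))
    (x : (TopCat.toSSet.obj (TopCat.of G)) _⦋2⦌) :
    circleCochain f (TopCat.toSSetObjEquiv (TopCat.of G) (.op ⦋1⦌)
        ((TopCat.toSSet.obj (TopCat.of G)).δ 0 x)) -
      circleCochain f (TopCat.toSSetObjEquiv (TopCat.of G) (.op ⦋1⦌)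
        ((TopCat.toSSet.obj (TopCat.of G)).δ 1 x)) +
      circleCochain f (TopCat.toSSetObjEquiv (TopCat.of G) (.op ⦋1⦌)
        ((TopCat.toSSet.obj (TopCat.of G)).δ 2 x)) = 0 := by
  obtain ⟨L, hL⟩ := exists_lift_addCircle (A := stdSimplex ℝ (Fin 3))
    (f.comp (TopCat.toSSetObjEquiv (TopCat.of G) (.op ⦋2⦌) x))
  have key : ∀ i : Fin 3, circleCochain f (TopCat.toSSetObjEquiv (TopCat.of G) (.op ⦋1⦌)
      ((TopCat.toSSet.obj (TopCat.of G)).δ i x)) =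
      L (stdSimplex.vertex (i.succAbove 1)) - L (stdSimplex.vertex (i.succAbove 0)) := by
    intro i
    rw [toSSetObjEquiv_δ, circleCochain_eq f _
      (L.comp ⟨stdSimplex.map i.succAbove, stdSimplex.continuous_map _⟩) (fun _ => hL _)]
    simp
  rw [key, key, key]
  have e1 : (0 : Fin 3).succAbove (1 : Fin 2) = 2 := by decide
  have e2 : (0 : Fin 3).succAbove (0 : Fin 2) = 1 := by decide
  have e3 : (1 : Fin 3).succAbove (1 : Fin 2) = 2 := by decide
  have e4 : (1 : Fin 3).succAbove (0 : Fin 2) = 0 := by decide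
  have e5 : (2 : Fin 3).succAbove (1 : Fin 2) = 1 := by decide
  have e6 : (2 : Fin 3).succAbove (0 : Fin 2) = 0 := by decide
  rw [e1, e2, e3, e4, e5, e6]
  ring

/-- The singular `1`-simplex of a path. -/
noncomputable def pathSimplex (γ : C(I, G)) : C(stdSimplex ℝ (Fin 2), G) :=
  γ.comp ⟨stdSimplexHomeomorphUnitInterval, stdSimplexHomeomorphUnitInterval.continuous⟩

lemma circleCochain_pathSimplex (f : C(G, AddCircle (1 : ℝ))) (γ : C(I, G)) (θ : C(I, ℝ))
    (hθ : ∀ t, ((θ t : ℝ) : AddCircle (1 : ℝ)) = f (γ t)) :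
    circleCochain f (pathSimplex γ) = θ 1 - θ 0 :=
  circleCochain_eq f _ (θ.comp ⟨stdSimplexHomeomorphUnitInterval,
    stdSimplexHomeomorphUnitInterval.continuous⟩) fun _ => hθ _

/-- Circle valued maps that pair triangularly with pairs of parallel paths bound the first Betti
number from below. -/
lemma card_le_firstBettiNumber {ι : Type*} (h : ι → ℝ) (a b : ι → C(I, G))
    (h0 : ∀ i, a i 0 = b i 0) (h1 : ∀ i, a i 1 = b i 1) (f : ι → C(G, AddCircle (1 : ℝ)))
    (hdiag : ∀ i, circleCochain (f i) (pathSimplex (a i)) -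
      circleCochain (f i) (pathSimplex (b i)) ≠ 0)
    (hoff : ∀ i j, j ≠ i → h j ≤ h i → circleCochain (f i) (pathSimplex (a j)) -
      circleCochain (f i) (pathSimplex (b j)) = 0) :
    ENat.card ι ≤ firstBettiNumber G := by
  let E := TopCat.toSSetObjEquiv (TopCat.of G) (.op ⦋1⦌)
  -- The face `δ 0` omits vertex `0`, so it is the end point of the path, and `δ 1` is the starting
  -- point.
  have hv : ∀ (i : Fin 2) (c d : C(I, G)), c (if i = 0 then 1 else 0) = d (if i = 0 then 1 else 0) →
      (TopCat.toSSet.obj (TopCat.of G)).δ i (E.symm (pathSimplex c)) =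
        (TopCat.toSSet.obj (TopCat.of G)).δ i (E.symm (pathSimplex d)) := by
    intro i c d hcd
    apply (TopCat.toSSetObjEquiv (TopCat.of G) (.op ⦋0⦌)).injective
    rw [toSSetObjEquiv_δ, toSSetObjEquiv_δ]
    change (E (E.symm _)).comp _ = (E (E.symm _)).comp _
    rw [E.apply_symm_apply, E.apply_symm_apply]
    ext x
    have hx : x = stdSimplex.vertex 0 := Subsingleton.elim _ _
    subst hx
    simp only [ContinuousMap.comp_apply, ContinuousMap.coe_mk, stdSimplex.map_vertex, pathSimplex]
    fin_cases i
    · exact hcd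
    · exact hcd
  exact le_rank_homology_one_of_triangular (TopCat.toSSet.obj (TopCat.of G)) h
    (fun i => E.symm (pathSimplex (a i))) (fun i => E.symm (pathSimplex (b i)))
    (fun i => hv 0 _ _ (h1 i)) (fun i => hv 1 _ _ (h0 i))
    (fun i x => circleCochain (f i) (E x)) (fun i x => circleCochain_cocycle (f i) x)
    (fun i => by simpa using hdiag i) (fun i j hji hle => by simpa using hoff i j hji hle)

end CircleCocycle

end Homology

/-! ### The Reeb graph as a descent space -/

/-- A space with a height function `g` and a distance function `D`, modelled on the Reeb graph of
the distance from a point of a geodesic space: every point descends to the root `q` along a path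
parametrized by height, on which `D` is the difference of heights. -/
structure IsDescentSpace {G : Type u} [TopologicalSpace G] (g : G → ℝ) (D : G → G → ℝ) (q : G) :
    Prop where
  dist_self : ∀ x, D x x = 0
  dist_comm : ∀ x y, D x y = D y x
  dist_triangle : ∀ x y z, D x z ≤ D x y + D y z
  abs_sub_le : ∀ x y, |g x - g y| ≤ D x y
  continuous_height : Continuous g
  continuous_dist : ∀ m, Continuous fun x => D x m
  height_nonneg : ∀ x, 0 ≤ g x
  exists_descent : ∀ x, ∃ δ : ℝ → G, ContinuousOn δ (Set.Icc 0 (g x)) ∧ δ 0 = q ∧ δ (g x) = x ∧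
    (∀ c ∈ Set.Icc 0 (g x), g (δ c) = c) ∧
    ∀ c ∈ Set.Icc 0 (g x), ∀ c' ∈ Set.Icc 0 (g x), D (δ c) (δ c') = |c - c'|
  exists_path : ∀ x m, ∀ η > 0, ∃ γ : Path x m, ∀ t, D x (γ t) + D (γ t) m ≤ D x m + η

section ReebDistance

variable {X : Type u} [TopologicalSpace X]

lemma reebEDist_le_eVariationOn (f : X → ℝ) {x y : X} (γ : Path x y) {s t : I} (hst : s ≤ t) :
    reebEDist f (γ s) (γ t) ≤ eVariationOn (fun r : I => f (γ r)) (Set.Icc s t) := by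
  have hst' : (s : ℝ) ≤ t := hst
  have hmem : ∀ r : I, (1 - (r : ℝ)) * s + r * t ∈ Set.Icc (0 : ℝ) 1 := fun r =>
    ⟨add_nonneg (mul_nonneg (sub_nonneg.2 r.2.2) s.2.1) (mul_nonneg r.2.1 t.2.1), by
      nlinarith [r.2.1, r.2.2, s.2.1, s.2.2, t.2.1, t.2.2]⟩
  let δ : Path (γ s) (γ t) :=
    { toFun := fun r => γ ⟨(1 - (r : ℝ)) * s + r * t, hmem r⟩
      continuous_toFun := by fun_prop
      source' := by simp
      target' := by simp }
  refine (iInf_le _ δ).trans ?_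
  exact eVariationOn.comp_le_of_monotoneOn (fun r : I => f (γ r)) (s := Set.Icc s t)
    (t := Set.univ) (fun r : I => ⟨(1 - (r : ℝ)) * s + r * t, hmem r⟩)
    (fun a _ b _ hab => Subtype.mk_le_mk.2 (by
      have : (a : ℝ) ≤ b := hab
      nlinarith))
    (fun r _ => ⟨Subtype.mk_le_mk.2 (by nlinarith [r.2.1, r.2.2]),
      Subtype.mk_le_mk.2 (by nlinarith [r.2.1, r.2.2])⟩)

/-- Variation is additive at `t`, so an almost minimal path passes only through points that are
almost between its ends. -/
lemma reebEDist_add_le_lengthAlong (f : X → ℝ) {x y : X} (γ : Path x y) (t : I) :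
    reebEDist f x (γ t) + reebEDist f (γ t) y ≤ lengthAlong f γ := by
  have h1 := reebEDist_le_eVariationOn f γ (s := 0) (t := t) t.2.1
  have h2 := reebEDist_le_eVariationOn f γ (s := t) (t := 1) t.2.2
  rw [γ.source] at h1
  rw [γ.target] at h2
  have h3 := eVariationOn.Icc_add_Icc (fun r : I => f (γ r)) (s := Set.univ) (a := 0) (b := t)
    (c := 1) t.2.1 t.2.2 (Set.mem_univ _)
  simp only [Set.univ_inter] at h3
  exact (add_le_add h1 h2).trans (h3.trans_le (eVariationOn.mono _ (Set.subset_univ _)))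

lemma edist_le_reebEDist (f : X → ℝ) (x y : X) : edist (f x) (f y) ≤ reebEDist f x y := by
  refine le_iInf fun γ => ?_
  have := eVariationOn.edist_le (fun t : I => f (γ t)) (Set.mem_univ 0) (Set.mem_univ 1)
  rwa [γ.source, γ.target] at this

end ReebDistance

/-- A geodesic parametrized on `I` is `dist x y`-Lipschitz and `d(p, ·)` is `1`-Lipschitz. -/
lemma reebEDist_le_edist {X : Type u} [PseudoMetricSpace X] [GeodesicSpace X] (p x y : X) :
    reebEDist (fun z : X => dist p z) x y ≤ ENNReal.ofReal (dist x y) := by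
  obtain ⟨γ, h0, h1, hγ⟩ := GeodesicSpace.exists_geodesic x y
  have hd : (0 : ℝ) ≤ dist x y := dist_nonneg
  have hmem : ∀ t : I, (t : ℝ) * dist x y ∈ Set.Icc 0 (dist x y) := fun t =>
    ⟨mul_nonneg t.2.1 hd, mul_le_of_le_one_left hd t.2.2⟩
  have hdist : ∀ s t : I, dist (γ ((s : ℝ) * dist x y)) (γ ((t : ℝ) * dist x y))
      = dist x y * dist s t := by
    intro s t
    rw [hγ _ (hmem s) _ (hmem t), ← sub_mul, abs_mul, abs_of_nonneg hd, Subtype.dist_eq,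
      Real.dist_eq, mul_comm]
  have hlip : LipschitzWith (Real.toNNReal (dist x y)) (fun t : I => γ ((t : ℝ) * dist x y)) :=
    LipschitzWith.of_dist_le_mul fun s t => by rw [hdist, Real.coe_toNNReal _ hd]
  let δ : Path x y :=
    { toFun := fun t => γ ((t : ℝ) * dist x y)
      continuous_toFun := hlip.continuous
      source' := by simp [h0]
      target' := by simp [h1] }
  refine (iInf_le _ δ).trans ?_
  have hlip2 : LipschitzWith (1 * Real.toNNReal (dist x y)) (fun t : I => dist p (δ t)) :=
    (LipschitzWith.dist_right p).comp hlip
  have h2 := MonotoneOn.eVariationOn_eq (f := fun t : I => (t : ℝ)) (s := Set.univ)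
    (a := 0) (b := 1) (fun a _ b _ hab => hab) (Set.mem_univ _) (Set.mem_univ _)
  have h3 : (Set.univ ∩ Set.Icc (0 : I) 1) = Set.univ := by
    ext t; simp [unitInterval.le_one']
  rw [h3] at h2
  have hle : lengthAlong (fun z : X => dist p z) δ
      ≤ ((1 * Real.toNNReal (dist x y) : NNReal) : ℝ≥0∞)
        * eVariationOn (fun t : I => (t : ℝ)) Set.univ := by
    rw [lengthAlong, eVariationOn]
    refine iSup_le fun q => ?_
    refine le_trans (Finset.sum_le_sum (g := fun i => ((1 * Real.toNNReal (dist x y) : NNReal) :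
      ℝ≥0∞) * edist ((q.2.1 (i + 1) : I) : ℝ) ((q.2.1 i : I) : ℝ)) fun i _ => hlip2 _ _) ?_
    rw [← Finset.mul_sum]
    exact mul_le_mul_right (eVariationOn.sum_le q.2.2.1 q.2.2.2) _
  refine hle.trans (le_of_eq ?_)
  rw [h2]
  simp [ENNReal.ofReal]

section ReebGraph

variable {X : Type u} [PseudoMetricSpace X]

/-- The height function induced by `d(p, ·)` on the Reeb graph. -/
def reebHeight (p : X) : ReebGraph p → ℝ :=
  Quotient.lift (fun x => dist p x) fun x y h => by
    obtain ⟨γ, hγ⟩ := h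
    simpa using (hγ 1).symm

/-- The distance `d_p` as a function on the topological Reeb graph. -/
noncomputable def reebDist [GeodesicSpace X] (p : X) (a b : ReebGraph p) : ℝ :=
  dist (show ReebMetricGraph p from a) (show ReebMetricGraph p from b)

lemma reebDist_mk [GeodesicSpace X] (p x y : X) :
    reebDist p (Quotient.mk _ x) (Quotient.mk _ y) =
      (reebEDist (fun z => dist p z) x y).toReal := rfl

lemma reebDist_mk_le_dist [GeodesicSpace X] (p x y : X) :
    reebDist p (Quotient.mk _ x) (Quotient.mk _ y) ≤ dist x y := by
  rw [reebDist_mk]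
  exact ENNReal.toReal_le_of_le_ofReal dist_nonneg (reebEDist_le_edist p x y)

/-- Descents are the images of geodesics from `p`: there the distance from `p` is the parameter, so
`d_p` is squeezed between the difference of heights and the distance in `X`. Since `d_p ≤ d`, the
function `d_p(·, m)` is `1`-Lipschitz on `X` and hence continuous for the quotient topology. -/
lemma isDescentSpace_reebGraph [GeodesicSpace X] (p : X) :
    IsDescentSpace (reebHeight p) (reebDist p) (Quotient.mk _ p) where
  dist_self x := dist_self (show ReebMetricGraph p from x)
  dist_comm x y := dist_comm (show ReebMetricGraph p from x) (show ReebMetricGraph p from y)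
  dist_triangle x y z := dist_triangle (show ReebMetricGraph p from x)
    (show ReebMetricGraph p from y) (show ReebMetricGraph p from z)
  abs_sub_le a b := by
    induction a, b using Quotient.inductionOn₂ with
    | _ x y =>
      rw [reebDist_mk]
      have := ENNReal.toReal_mono (reebEDist_ne_top p x y)
        (edist_le_reebEDist (fun z => dist p z) x y)
      rwa [edist_dist, ENNReal.toReal_ofReal dist_nonneg, Real.dist_eq] at this
  continuous_height := Continuous.quotient_lift (by fun_prop) _
  continuous_dist m := by
    induction m using Quotient.inductionOn with
    | _ y =>
      refine isQuotientMap_quotient_mk'.continuous_iff.2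
        (LipschitzWith.of_le_add fun x x' => ?_).continuous
      have h1 := dist_triangle (show ReebMetricGraph p from Quotient.mk _ x)
        (show ReebMetricGraph p from Quotient.mk _ x') (show ReebMetricGraph p from Quotient.mk _ y)
      have h2 := reebDist_mk_le_dist p x x'
      change reebDist p (Quotient.mk _ x) (Quotient.mk _ y) ≤
        reebDist p (Quotient.mk _ x') (Quotient.mk _ y) + dist x x'
      change reebDist p _ _ ≤ reebDist p _ _ + reebDist p _ _ at h1
      linarith
  height_nonneg a := by
    induction a using Quotient.inductionOn with
    | _ x => exact dist_nonneg
  exists_descent a := by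
    induction a using Quotient.inductionOn with
    | _ x =>
      obtain ⟨γ, h0, h1, hγ⟩ := GeodesicSpace.exists_geodesic p x
      have hheight : ∀ c ∈ Set.Icc 0 (dist p x), dist p (γ c) = c := by
        intro c hc
        rw [← h0, hγ 0 ⟨le_rfl, dist_nonneg⟩ c hc, zero_sub, abs_neg, abs_of_nonneg hc.1]
      refine ⟨fun c => Quotient.mk _ (γ c), ?_, by simp only [h0], congrArg _ h1, hheight, ?_⟩
      · refine continuous_quotient_mk'.comp_continuousOn ?_
        refine (LipschitzOnWith.of_dist_le_mul (K := 1) fun c hc c' hc' => ?_).continuousOn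
        rw [hγ c hc c' hc', Real.dist_eq, NNReal.coe_one, one_mul]
      · intro c hc c' hc'
        refine le_antisymm ((reebDist_mk_le_dist p _ _).trans (hγ c hc c' hc').le) ?_
        rw [reebDist_mk]
        have := ENNReal.toReal_mono (reebEDist_ne_top p (γ c) (γ c'))
          (edist_le_reebEDist (fun z => dist p z) (γ c) (γ c'))
        rwa [edist_dist, ENNReal.toReal_ofReal dist_nonneg, Real.dist_eq, hheight c hc,
          hheight c' hc'] at this
  exists_path a b := by
    induction a, b using Quotient.inductionOn₂ with
    | _ x y =>
      intro η hη
      have hlt : reebEDist (fun z => dist p z) x y <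
          reebEDist (fun z => dist p z) x y + ENNReal.ofReal η :=
        ENNReal.lt_add_right (reebEDist_ne_top p x y) (ENNReal.ofReal_pos.2 hη).ne'
      obtain ⟨γ, hγ⟩ := iInf_lt_iff.1 hlt
      refine ⟨γ.map continuous_quotient_mk', fun t => ?_⟩
      have h := (reebEDist_add_le_lengthAlong (fun z => dist p z) γ t).trans hγ.le
      have h' := ENNReal.toReal_mono (ENNReal.add_ne_top.2 ⟨reebEDist_ne_top p x y,
        ENNReal.ofReal_ne_top⟩) h
      rwa [ENNReal.toReal_add (reebEDist_ne_top p x _) (reebEDist_ne_top p _ y),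
        ENNReal.toReal_add (reebEDist_ne_top p x y) ENNReal.ofReal_ne_top,
        ENNReal.toReal_ofReal hη.le] at h'

end ReebGraph

/-! ### Regular points and the distance between the ends of a path -/

open Topology in
/-- A point is regular if every descent from it can be followed from all nearby points. -/
def IsRegularPoint {G : Type u} [TopologicalSpace G] (g : G → ℝ) (D : G → G → ℝ) (x : G) : Prop :=
  ∃ N ∈ 𝓝 x, ∀ x' ∈ N, ∀ m, D x m = g x - g m → g m ≤ g x' → D x' m = g x' - g m

namespace IsDescentSpace

variable {G : Type u} [TopologicalSpace G] {g : G → ℝ} {D : G → G → ℝ} {q : G}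

/-- The parameters from which the lowest point `b r₀` is reached by pure descent form a closed set
by continuity and an open one by regularity. Minimality of `r₀` supplies the height condition in
`IsRegularPoint`. -/
lemma dist_eq_sub_of_regular (h : IsDescentSpace g D q) {b : ℝ → G} (hb : Continuous b) {s t : ℝ}
    (hreg : ∀ r ∈ Set.Icc s t, IsRegularPoint g D (b r)) {r₀ : ℝ} (hr₀ : r₀ ∈ Set.Icc s t)
    (hmin : ∀ r ∈ Set.Icc s t, g (b r₀) ≤ g (b r)) {r : ℝ} (hr : r ∈ Set.Icc s t) :
    D (b r) (b r₀) = g (b r) - g (b r₀) := by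
  have : PreconnectedSpace (Set.Icc s t) := Subtype.preconnectedSpace isPreconnected_Icc
  let S : Set (Set.Icc s t) := {r | D (b r) (b r₀) = g (b r) - g (b r₀)}
  have hclosed : IsClosed S := isClosed_eq
    ((h.continuous_dist _).comp (hb.comp continuous_subtype_val))
    ((h.continuous_height.comp (hb.comp continuous_subtype_val)).sub continuous_const)
  have hopen : IsOpen S := by
    refine isOpen_iff_mem_nhds.2 fun r hrS => ?_
    obtain ⟨N, hN, hreg'⟩ := hreg r r.2
    filter_upwards [(hb.comp continuous_subtype_val).continuousAt.preimage_mem_nhds hN]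
      with r' hr'
    exact hreg' _ hr' _ hrS (hmin r' r'.2)
  have huniv : S = Set.univ := IsClopen.eq_univ ⟨hclosed, hopen⟩
    ⟨⟨r₀, hr₀⟩, by simp [S, h.dist_self]⟩
  have : (⟨r, hr⟩ : Set.Icc s t) ∈ S := huniv ▸ Set.mem_univ _
  exact this

/-- Both ends descend to the lowest point, and the triangle inequality through it gives the bound.
-/
lemma exists_dist_le_of_regular (h : IsDescentSpace g D q) {b : ℝ → G} (hb : Continuous b)
    {s t : ℝ} (hst : s ≤ t) (hreg : ∀ r ∈ Set.Ioo s t, IsRegularPoint g D (b r)) :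
    ∃ r₀ ∈ Set.Icc s t, D (b s) (b t) ≤ g (b s) + g (b t) - 2 * g (b r₀) := by
  obtain ⟨r₀, hr₀, hmin⟩ := isCompact_Icc.exists_isMinOn (Set.nonempty_Icc.2 hst)
    (h.continuous_height.comp hb).continuousOn
  refine ⟨r₀, hr₀, ?_⟩
  rcases hst.eq_or_lt with rfl | hlt
  · obtain rfl : r₀ = s := le_antisymm hr₀.2 hr₀.1
    rw [h.dist_self]; linarith
  have hinner : ∀ s' t', s < s' → s' ≤ t' → t' < t →
      D (b s') (b t') ≤ g (b s') + g (b t') - 2 * g (b r₀) := by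
    intro s' t' h1 h2 h3
    obtain ⟨r, hr, hrmin⟩ := isCompact_Icc.exists_isMinOn (Set.nonempty_Icc.2 h2)
      (h.continuous_height.comp hb).continuousOn
    have hreg' : ∀ r ∈ Set.Icc s' t', IsRegularPoint g D (b r) := fun r hr =>
      hreg r ⟨h1.trans_le hr.1, hr.2.trans_lt h3⟩
    have e1 := h.dist_eq_sub_of_regular hb hreg' hr hrmin ⟨le_rfl, h2⟩
    have e2 := h.dist_eq_sub_of_regular hb hreg' hr hrmin ⟨h2, le_rfl⟩
    have e3 : g (b r₀) ≤ g (b r) := hmin ⟨h1.le.trans hr.1, hr.2.trans h3.le⟩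
    have e4 := h.dist_triangle (b s') (b r) (b t')
    rw [h.dist_comm (b r) (b t'), e1, e2] at e4
    linarith
  -- The ends may be irregular, so the bound is first obtained on `[s + ε, t - ε]`; `F ε ≤ 0`
  -- records it with the distances to the true ends, and continuity gives `F 0 ≤ 0`.
  let F : ℝ → ℝ := fun ε => D (b s) (b t) - D (b (s + ε)) (b s) - D (b (t - ε)) (b t)
    - g (b (s + ε)) - g (b (t - ε)) + 2 * g (b r₀)
  have hF : Continuous F := by
    have c1 := (h.continuous_dist (b s)).comp (hb.comp (continuous_const_add s))
    have c2 := (h.continuous_dist (b t)).comp (hb.comp (continuous_sub_left t))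
    have c3 := h.continuous_height.comp (hb.comp (continuous_const_add s))
    have c4 := h.continuous_height.comp (hb.comp (continuous_sub_left t))
    exact ((((continuous_const.sub c1).sub c2).sub c3).sub c4).add continuous_const
  have hF0 : F 0 ≤ 0 := by
    refine le_of_tendsto (hF.continuousAt.continuousWithinAt (s := Set.Ioi 0)) ?_
    filter_upwards [Ioo_mem_nhdsGT (show (0 : ℝ) < (t - s) / 2 by linarith)] with ε hε
    have e1 := hinner (s + ε) (t - ε) (by linarith [hε.1]) (by linarith [hε.2]) (by linarith [hε.1])
    have e2 := h.dist_triangle (b s) (b (s + ε)) (b t)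
    have e3 := h.dist_triangle (b (s + ε)) (b (t - ε)) (b t)
    rw [h.dist_comm (b s) (b (s + ε))] at e2
    simp only [F]
    linarith
  simp only [F, add_zero, sub_zero, h.dist_self] at hF0
  linarith

variable {W : ℝ → ℝ} {ε : ℝ} {b : ℝ → G}

/-- The height drop from each end to the lowest point costs an error `2 * ε`. -/
lemma dist_le_of_regular (h : IsDescentSpace g D q) (hb : Continuous b) {s t : ℝ} (hst : s ≤ t)
    (hW : ∀ r r', s ≤ r → r ≤ r' → r' ≤ t → |g (b r) - g (b r')| ≤ W r' - W r + 2 * ε)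
    (hreg : ∀ r ∈ Set.Ioo s t, IsRegularPoint g D (b r)) :
    D (b s) (b t) ≤ W t - W s + 4 * ε := by
  obtain ⟨r, hr, hle⟩ := h.exists_dist_le_of_regular hb hst hreg
  have h1 := (le_abs_self _).trans (hW s r le_rfl hr.1 hr.2)
  have h2 := (neg_le_abs _).trans (hW r t hr.1 hr.2 le_rfl)
  linarith

/-- Induction on the irregular points still ahead. Up to the first visit `r₁` of `F` the path is
regular; then it jumps to the last visit `r₂` of the same point, which is never met again and leaves
`F`. The jump moves no distance and only loses `W`, which is monotone. Each of the at most `F.card +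
1` stretches costs `4 * ε`. -/
lemma dist_le_of_forall_mem (h : IsDescentSpace g D q) [T2Space G] (hb : Continuous b) {t : ℝ}
    (hWmono : Monotone W) (hε : 0 ≤ ε)
    (F : Finset G) : ∀ s ≤ t,
    (∀ r r', s ≤ r → r ≤ r' → r' ≤ t → |g (b r) - g (b r')| ≤ W r' - W r + 2 * ε) →
    (∀ r ∈ Set.Ioc s t, ¬ IsRegularPoint g D (b r) → b r ∈ F) → b s ∉ F →
    D (b s) (b t) ≤ W t - W s + 4 * (F.card + 1) * ε := by
  classical
  induction F using Finset.strongInduction with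
  | H F ih =>
    intro s hst hW hF hs
    by_cases hne : ∃ r ∈ Set.Icc s t, b r ∈ F
    · have hcl : IsClosed {r | b r ∈ F} := F.finite_toSet.isClosed.preimage hb
      have hcpt : IsCompact (Set.Icc s t ∩ {r | b r ∈ F}) := isCompact_Icc.inter_right hcl
      obtain ⟨r₁, ⟨hr₁, hr₁F⟩, hr₁min⟩ := hcpt.exists_isLeast hne
      have hcl₂ : IsClosed {r | b r = b r₁} := isClosed_singleton.preimage hb
      obtain ⟨r₂, ⟨hr₂, hr₂v⟩, hr₂max⟩ := (isCompact_Icc.inter_right hcl₂).exists_isGreatest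
        (s := Set.Icc s t ∩ {r | b r = b r₁}) ⟨r₁, hr₁, rfl⟩
      have hr₂v : b r₂ = b r₁ := hr₂v
      have hr₁F : b r₁ ∈ F := hr₁F
      have h12 : r₁ ≤ r₂ := hr₂max ⟨hr₁, rfl⟩
      have e1 : D (b s) (b r₁) ≤ W r₁ - W s + 4 * ε := by
        refine h.dist_le_of_regular hb hr₁.1
          (fun r r' h1 h2 h3 => hW r r' h1 h2 (h3.trans hr₁.2)) fun r hr => ?_
        by_contra hreg
        exact absurd (hr₁min ⟨⟨hr.1.le, hr.2.le.trans hr₁.2⟩,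
          hF r ⟨hr.1, hr.2.le.trans hr₁.2⟩ hreg⟩) (not_le.2 hr.2)
      have e2 : D (b r₂) (b t) ≤ W t - W r₂ + 4 * ((F.erase (b r₁)).card + 1) * ε := by
        refine ih _ (Finset.erase_ssubset hr₁F) r₂ hr₂.2
          (fun r r' h1 h2 h3 => hW r r' (hr₂.1.trans h1) h2 h3) (fun r hr hreg => ?_) ?_
        · refine Finset.mem_erase.2 ⟨fun hv => ?_, hF r ⟨hr₂.1.trans_lt hr.1, hr.2⟩ hreg⟩
          exact absurd (hr₂max ⟨⟨hr₂.1.trans hr.1.le, hr.2⟩, hv⟩) (not_le.2 hr.1)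
        · rw [hr₂v]; exact Finset.notMem_erase _ _
      have hcard : ((F.erase (b r₁)).card : ℝ) + 1 = F.card := by
        exact_mod_cast Finset.card_erase_add_one hr₁F
      rw [hcard, hr₂v] at e2
      have e3 := h.dist_triangle (b s) (b r₁) (b t)
      have e4 := hWmono h12
      linarith
    · push Not at hne
      have e1 : D (b s) (b t) ≤ W t - W s + 4 * ε := by
        refine h.dist_le_of_regular hb hst hW fun r hr => ?_
        by_contra hreg
        exact hne r ⟨hr.1.le, hr.2.le⟩ (hF r ⟨hr.1, hr.2.le⟩ hreg)
      have : 0 ≤ 4 * (F.card : ℝ) * ε := by positivity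
      linarith

/-- A path whose height is close to a function of bounded variation bounds the distance of its ends
up to an error proportional to the number of irregular points. -/
lemma dist_le_of_path (h : IsDescentSpace g D q) [T2Space G] (hb : Continuous b)
    (hWmono : Monotone W) (hε : 0 ≤ ε) (F : Finset G) (hF : ∀ x, ¬ IsRegularPoint g D x → x ∈ F)
    {s t : ℝ} (hst : s ≤ t)
    (hW : ∀ r r', s ≤ r → r ≤ r' → r' ≤ t → |g (b r) - g (b r')| ≤ W r' - W r + 2 * ε) :
    D (b s) (b t) ≤ W t - W s + 4 * (F.card + 1) * ε := by
  classical
  -- The starting point may itself be irregular; beginning at its last visit removes it from the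
  -- finite set without an additional stretch.
  obtain ⟨r₂, ⟨hr₂, hr₂v⟩, hr₂max⟩ := (isCompact_Icc.inter_right
    ((isClosed_singleton (x := b s)).preimage hb)).exists_isGreatest
    (s := Set.Icc s t ∩ b ⁻¹' {b s}) ⟨s, ⟨le_rfl, hst⟩, rfl⟩
  have hr₂v : b r₂ = b s := hr₂v
  have e := h.dist_le_of_forall_mem hb hWmono hε (F.erase (b s)) r₂ hr₂.2
    (fun r r' h1 h2 h3 => hW r r' (hr₂.1.trans h1) h2 h3) (fun r hr hreg => ?_)
    (by rw [hr₂v]; exact Finset.notMem_erase _ _)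
  · rw [hr₂v] at e
    have e1 : ((F.erase (b s)).card : ℝ) ≤ F.card := by
      exact_mod_cast Finset.card_le_card (Finset.erase_subset _ _)
    have e2 := hWmono hr₂.1
    nlinarith
  · refine Finset.mem_erase.2 ⟨fun hv => ?_, hF _ hreg⟩
    exact absurd (hr₂max ⟨⟨hr₂.1.trans hr.1.le, hr.2⟩, hv⟩) (not_le.2 hr.1)

end IsDescentSpace

/-! ### Decompositions into arcs parametrized by height -/

/-- A decomposition of a space with height function `g` into a finite set of vertices and finitely
many open arcs between them, each of them parametrized by height. -/
structure IsArcDecomposition {G : Type u} [TopologicalSpace G] (g : G → ℝ) (V : Set G)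
    {ι : Type*} (a b : ι → ℝ) (s : ι → ℝ → G) : Prop where
  lt : ∀ i, a i < b i
  continuousOn : ∀ i, ContinuousOn (s i) (Set.Icc (a i) (b i))
  height : ∀ i, ∀ c ∈ Set.Icc (a i) (b i), g (s i c) = c
  isOpen : ∀ i, IsOpen (s i '' Set.Ioo (a i) (b i))
  bot_mem : ∀ i, s i (a i) ∈ V
  top_mem : ∀ i, s i (b i) ∈ V
  notMem : ∀ i, ∀ c ∈ Set.Ioo (a i) (b i), s i c ∉ V
  index_eq : ∀ i j, ∀ c ∈ Set.Ioo (a i) (b i), ∀ c' ∈ Set.Ioo (a j) (b j), s i c = s j c' → i = j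
  cover : ∀ x, x ∈ V ∨ ∃ i, ∃ c ∈ Set.Ioo (a i) (b i), s i c = x

namespace IsArcDecomposition

variable {G : Type u} [TopologicalSpace G] [T2Space G] {g : G → ℝ} {D : G → G → ℝ} {q : G}
  {V : Set G} {ι : Type*} {a b : ι → ℝ} {s : ι → ℝ → G}

/-- A path parametrized by height that meets an open arc follows it. -/
lemma eq_of_mem (A : IsArcDecomposition g V a b s) {i : ι} {δ : ℝ → G} {c d : ℝ}
    (hcd : Set.Icc c d ⊆ Set.Ioo (a i) (b i)) (hδ : ContinuousOn δ (Set.Icc c d))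
    (hg : ∀ r ∈ Set.Icc c d, g (δ r) = r) {r₀ : ℝ} (hr₀ : r₀ ∈ Set.Icc c d)
    (h₀ : δ r₀ ∈ s i '' Set.Ioo (a i) (b i)) {r : ℝ} (hr : r ∈ Set.Icc c d) : δ r = s i r := by
  have hmem : ∀ r ∈ Set.Icc c d, δ r ∈ s i '' Set.Ioo (a i) (b i) → δ r = s i r := by
    rintro r hr ⟨c', hc', h⟩
    have := A.height i c' (Set.Ioo_subset_Icc_self hc')
    rw [h, hg r hr] at this
    rw [← h, this]
  have : PreconnectedSpace (Set.Icc c d) := Subtype.preconnectedSpace isPreconnected_Icc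
  have hδ' : Continuous fun r : Set.Icc c d => δ r := hδ.domRestrict
  have hs' : Continuous fun r : Set.Icc c d => s i r :=
    ((A.continuousOn i).mono (hcd.trans Set.Ioo_subset_Icc_self)).domRestrict
  let S : Set (Set.Icc c d) := {r | δ r = s i r}
  have hclosed : IsClosed S := isClosed_eq hδ' hs'
  have hopen : IsOpen S := by
    refine isOpen_iff_mem_nhds.2 fun r hrS => ?_
    have hrS : δ r = s i r := hrS
    have hn : s i '' Set.Ioo (a i) (b i) ∈ nhds (δ r) :=
      (A.isOpen i).mem_nhds (hrS ▸ Set.mem_image_of_mem _ (hcd r.2))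
    filter_upwards [hδ'.continuousAt.preimage_mem_nhds hn] with r' hr'
    exact hmem r' r'.2 hr'
  have huniv : S = Set.univ := IsClopen.eq_univ ⟨hclosed, hopen⟩ ⟨⟨r₀, hr₀⟩, hmem _ hr₀ h₀⟩
  have : (⟨r, hr⟩ : Set.Icc c d) ∈ S := huniv ▸ Set.mem_univ _
  exact this

/-- The descent from a point of the open arc follows the arc by `eq_of_mem`, and on a descent `D` is
the difference of heights. The ends of the arc follow by continuity. -/
lemma dist_eq (A : IsArcDecomposition g V a b s) (h : IsDescentSpace g D q) (i : ι) {c c' : ℝ}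
    (hc : c ∈ Set.Icc (a i) (b i)) (hc' : c' ∈ Set.Icc (a i) (b i)) :
    D (s i c) (s i c') = |c - c'| := by
  have hle : ∀ c ∈ Set.Ioo (a i) (b i), ∀ c' ∈ Set.Ioo (a i) (b i), c ≤ c' →
      D (s i c) (s i c') = |c - c'| := by
    intro c hc c' hc' hle
    have hht := A.height i c' (Set.Ioo_subset_Icc_self hc')
    have hhc := A.height i c (Set.Ioo_subset_Icc_self hc)
    obtain ⟨δ, hδ, -, htop, hg, hD⟩ := h.exists_descent (s i c')
    rw [hht] at hδ htop hg hD
    have h0c : 0 ≤ c := hhc ▸ h.height_nonneg _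
    have hsub : Set.Icc c c' ⊆ Set.Icc 0 c' := Set.Icc_subset_Icc_left h0c
    have hsub' : Set.Icc c c' ⊆ Set.Ioo (a i) (b i) := fun r hr =>
      ⟨hc.1.trans_le hr.1, hr.2.trans_lt hc'.2⟩
    have := A.eq_of_mem hsub' (hδ.mono hsub) (fun r hr => hg r (hsub hr)) ⟨hle, le_rfl⟩
      (htop ▸ Set.mem_image_of_mem _ hc') ⟨le_rfl, hle⟩
    rw [← this, ← htop]
    exact hD c ⟨h0c, hle⟩ c' ⟨h0c.trans hle, le_rfl⟩
  have hopen : ∀ c ∈ Set.Ioo (a i) (b i), ∀ c' ∈ Set.Ioo (a i) (b i),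
      D (s i c) (s i c') = |c - c'| := by
    intro c hc c' hc'
    rcases le_total c c' with hl | hl
    · exact hle c hc c' hc' hl
    · rw [h.dist_comm, hle c' hc' c hc hl, abs_sub_comm]
  have hclos : Set.Icc (a i) (b i) ⊆ closure (Set.Ioo (a i) (b i)) :=
    (closure_Ioo (A.lt i).ne).ge
  have hhalf : ∀ c' ∈ Set.Ioo (a i) (b i), ∀ c ∈ Set.Icc (a i) (b i),
      D (s i c) (s i c') = |c - c'| := fun c' hc' c hc =>
    Set.EqOn.of_subset_closure (f := fun c => D (s i c) (s i c')) (g := fun c => |c - c'|)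
      (fun c hc => hopen c hc c' hc')
      ((h.continuous_dist _).comp_continuousOn (A.continuousOn i)) (by fun_prop)
      Set.Ioo_subset_Icc_self hclos hc
  refine Set.EqOn.of_subset_closure (f := fun c' => D (s i c) (s i c'))
      (g := fun c' => |c - c'|) (fun c' hc' => hhalf c' hc' c hc)
      ?_ (by fun_prop) Set.Ioo_subset_Icc_self hclos hc'
  simp only [h.dist_comm (s i c)]
  exact (h.continuous_dist _).comp_continuousOn (A.continuousOn i)

lemma isClosed_arc (A : IsArcDecomposition g V a b s) (i : ι) :
    IsClosed (s i '' Set.Icc (a i) (b i)) :=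
  (isCompact_Icc.image_of_continuousOn (A.continuousOn i)).isClosed

/-- A point from which at most one arc descends is regular. -/
lemma isRegularPoint [Finite ι] (A : IsArcDecomposition g V a b s) (hV : V.Finite)
    (h : IsDescentSpace g D q) {v : G}
    (hv : ∀ i j, g v ∈ Set.Ioc (a i) (b i) → g v ∈ Set.Ioc (a j) (b j) → s i (g v) = v →
      s j (g v) = v → i = j) :
    IsRegularPoint g D v := by
  let P : ι → Prop := fun i => g v ∈ Set.Icc (a i) (b i) ∧ s i (g v) = v
  -- The complement of `Cl` is the neighbourhood of `v` that consists of `v` and the open arcs whose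
  -- closure contains `v`.
  let Cl : Set G := (V \ {v}) ∪ ⋃ i : {i // ¬ P i}, s i '' Set.Icc (a i) (b i)
  have hCl : IsClosed Cl := (hV.subset Set.sdiff_subset).isClosed.union
    (isClosed_iUnion_of_finite fun i => A.isClosed_arc i)
  have hP : ∀ i, v ∈ s i '' Set.Icc (a i) (b i) → P i := by
    rintro i ⟨c, hc, rfl⟩
    simp only [P, A.height i c hc]
    exact ⟨hc, trivial⟩
  have hvN : v ∈ Clᶜ := by
    rintro (hv' | hv')
    · exact hv'.2 rfl
    · obtain ⟨i, hi⟩ := Set.mem_iUnion.1 hv'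
      exact i.2 (hP _ hi)
  have hN : ∀ x ∈ Clᶜ, x = v ∨ ∃ i, ∃ c ∈ Set.Ioo (a i) (b i), P i ∧ s i c = x := by
    intro x hx
    by_cases hxv : x = v
    · exact Or.inl hxv
    · right
      rcases A.cover x with hxV | ⟨i, c, hc, rfl⟩
      · exact absurd (Or.inl ⟨hxV, hxv⟩) hx
      · refine ⟨i, c, hc, ?_, rfl⟩
        by_contra hPi
        exact hx (Or.inr (Set.mem_iUnion.2 ⟨⟨i, hPi⟩, c, Set.Ioo_subset_Icc_self hc, rfl⟩))
  have hN' : ∀ i, ∀ c ∈ Set.Ioo (a i) (b i), P i → s i c ∈ Clᶜ := by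
    rintro i c hc hPi (hx | hx)
    · exact A.notMem i c hc hx.1
    · obtain ⟨j, c', hc', he⟩ := Set.mem_iUnion.1 hx
      rcases hc'.1.eq_or_lt with h1 | h1
      · exact A.notMem i c hc (by rw [← he, ← h1]; exact A.bot_mem _)
      · rcases hc'.2.eq_or_lt with h2 | h2
        · exact A.notMem i c hc (by rw [← he, h2]; exact A.top_mem _)
        · have := A.index_eq _ _ c' ⟨h1, h2⟩ c hc he
          exact j.2 (this ▸ hPi)
  -- A path that rises by less than `η₀` above `v` cannot reach the upper end of an arc ascending
  -- from `v`.
  obtain ⟨η₀, hη₀, hη₀b⟩ : ∃ η₀ > 0, ∀ j, g v < b j → g v + η₀ ≤ b j := by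
    have : ∀ᶠ η in nhdsWithin (0 : ℝ) (Set.Ioi 0), ∀ j, g v < b j → g v + η ≤ b j := by
      refine Filter.eventually_all.2 fun j => ?_
      by_cases hj : g v < b j
      · filter_upwards [Ioo_mem_nhdsGT (sub_pos.2 hj)] with η hη _
        linarith [hη.2]
      · exact Filter.Eventually.of_forall fun _ h => absurd h hj
    obtain ⟨η, h1, h2⟩ := (this.and self_mem_nhdsWithin).exists
    exact ⟨η, h2, h1⟩
  refine ⟨Clᶜ, hCl.isOpen_compl.mem_nhds hvN, fun x hx m hm hmx => ?_⟩
  rcases hN x hx with rfl | ⟨i, c, hc, hPi, rfl⟩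
  · exact hm
  have hgc := A.height i c (Set.Ioo_subset_Icc_self hc)
  rw [hgc] at hmx ⊢
  have hge : c - g m ≤ D (s i c) m := by
    have := (le_abs_self _).trans (h.abs_sub_le (s i c) m)
    rwa [hgc] at this
  refine le_antisymm ?_ hge
  -- A point above `v` first descends to `v` along its arc and then continues to `m`.
  rcases le_or_gt (g v) c with hcv | hcv
  · have h1 := A.dist_eq h i (Set.Ioo_subset_Icc_self hc) hPi.1
    rw [hPi.2, abs_of_nonneg (sub_nonneg.2 hcv)] at h1
    have h2 := h.dist_triangle (s i c) v m
    linarith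
  -- A point below `v` lies on the only arc descending from `v`. An almost minimal path from `v` to
  -- `m` has to pass through it, which gives the bound up to the excess `η`.
  refine le_of_forall_pos_le_add fun η' hη' => ?_
  obtain ⟨η, hη, hηη', hηη₀⟩ : ∃ η > 0, η ≤ η' ∧ η ≤ η₀ :=
    ⟨min η' η₀, lt_min hη' hη₀, min_le_left _ _, min_le_right _ _⟩
  obtain ⟨γ, hγ⟩ := h.exists_path v m η hη
  have hlow : ∀ t, g (γ t) < g v + η₀ := by
    intro t
    have h1 := (neg_le_abs _).trans (h.abs_sub_le v (γ t))
    have h2 := (le_abs_self _).trans (h.abs_sub_le (γ t) m)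
    have h3 := hγ t
    linarith
  obtain ⟨t, ht⟩ : ∃ t, γ t = s i c := by
    by_contra! hne
    -- If the path avoided `s i c`, it would stay in `W`, the part of the neighbourhood above height
    -- `c`: it could leave only through `s i c`, through the bottom of the descending arc, which is
    -- too low, or through the top of an ascending arc, which is too high. But `m` is not above
    -- height `c`.
    let W : Set G := Clᶜ ∩ {x | c < g x}
    have hWopen : IsOpen W := hCl.isOpen_compl.inter
      (isOpen_lt continuous_const h.continuous_height)
    let K : Set G := {v} ∪ ⋃ j : {j // P j}, s j '' Set.Icc (a j) (b j)
    have hK : IsClosed K := isClosed_singleton.union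
      (isClosed_iUnion_of_finite fun j => A.isClosed_arc j)
    have hWK : closure W ⊆ K ∩ {x | c ≤ g x} := by
      refine closure_minimal (fun x hx => ⟨?_, show c ≤ g x from le_of_lt hx.2⟩)
        (hK.inter (isClosed_le continuous_const h.continuous_height))
      rcases hN x hx.1 with rfl | ⟨j, c', hc', hPj, rfl⟩
      · exact Or.inl rfl
      · exact Or.inr (Set.mem_iUnion.2 ⟨⟨j, hPj⟩, c', Set.Ioo_subset_Icc_self hc', rfl⟩)
    have hvW : v ∈ W := ⟨hvN, hcv⟩
    have hclosed : IsClosed (γ ⁻¹' W) := by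
      refine isClosed_of_closure_subset fun t ht => ?_
      have ht' : γ t ∈ closure W := γ.continuous.closure_preimage_subset _ ht
      obtain ⟨hx, hcx⟩ := hWK ht'
      have hcx : c ≤ g (γ t) := hcx
      change γ t ∈ W
      rcases hx with hx | hx
      · rw [Set.mem_singleton_iff.1 hx]; exact hvW
      obtain ⟨⟨j, hPj⟩, c', hc', he⟩ := Set.mem_iUnion.1 hx
      simp only at hc' he
      have hgc' := A.height j c' hc'
      rw [he] at hgc'
      have hij : a j < g v → j = i := fun hj => hv j i ⟨hj, hPj.1.2⟩
        ⟨hc.1.trans hcv, hPi.1.2⟩ hPj.2 hPi.2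
      have hgv : c' = g v → γ t ∈ W := fun h1 => by
        rw [← he, h1, hPj.2]; exact hvW
      rcases hc'.1.eq_or_lt with h1 | h1
      · rcases hPj.1.1.eq_or_lt with h2 | h2
        · exact hgv (h1.symm.trans h2)
        · have := hij h2
          subst this
          linarith [hc.1]
      · rcases hc'.2.eq_or_lt with h2 | h2
        · rcases hPj.1.2.eq_or_lt with h3 | h3
          · exact hgv (h2.trans h3.symm)
          · linarith [hη₀b j h3, hlow t]
        · refine ⟨he ▸ hN' j c' ⟨h1, h2⟩ hPj, lt_of_le_of_ne hcx fun hcc => ?_⟩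
          have hcc' : c = c' := hcc.trans hgc'
          have := hij (h1.trans (hcc' ▸ hcv))
          subst this
          exact hne t (by rw [← he, hcc'])
    have huniv : γ ⁻¹' W = Set.univ := IsClopen.eq_univ
      ⟨hclosed, hWopen.preimage γ.continuous⟩ ⟨0, by simpa using hvW⟩
    have hm : (1 : I) ∈ γ ⁻¹' W := huniv ▸ Set.mem_univ _
    rw [Set.mem_preimage, γ.target] at hm
    exact absurd hm.2 (not_lt.2 hmx)
  have h1 := hγ t
  rw [ht] at h1
  have h2 := (le_abs_self _).trans (h.abs_sub_le v (s i c))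
  rw [hgc] at h2
  linarith

/-! ### Forks and the first Betti number -/

/-- The vertices from which two different arcs descend. -/
def forks (b : ι → ℝ) (s : ι → ℝ → G) : Set G :=
  {v | ∃ i j, i ≠ j ∧ s i (b i) = v ∧ s j (b j) = v}

/-- If two arcs descend from `v`, then `v` is interior to neither of them: an interior point lies on
a single arc and is no vertex. -/
lemma mem_forks_of_not_isRegularPoint [Finite ι] (A : IsArcDecomposition g V a b s)
    (hV : V.Finite) (h : IsDescentSpace g D q) {v : G} (hv : ¬ IsRegularPoint g D v) :
    v ∈ forks b s := by
  by_contra hf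
  refine hv (A.isRegularPoint hV h fun i j hi hj hvi hvj => ?_)
  by_contra hij
  rcases hi.2.eq_or_lt with h1 | h1
  · rcases hj.2.eq_or_lt with h2 | h2
    · exact hf ⟨i, j, hij, h1 ▸ hvi, h2 ▸ hvj⟩
    · exact A.notMem j (g v) ⟨hj.1, h2⟩ (by rw [hvj, ← hvi, h1]; exact A.top_mem i)
  · rcases hj.2.eq_or_lt with h2 | h2
    · exact A.notMem i (g v) ⟨hi.1, h1⟩ (by rw [hvi, ← hvj, h2]; exact A.top_mem j)
    · exact hij (A.index_eq i j _ ⟨hi.1, h1⟩ _ ⟨hj.1, h2⟩ (hvi.trans hvj.symm))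

omit [T2Space G] in
lemma forks_subset (A : IsArcDecomposition g V a b s) : forks b s ⊆ V := by
  rintro v ⟨i, -, -, rfl, -⟩
  exact A.top_mem i

/-- The map to the circle that collapses the complement of an open arc. -/
lemma exists_collapse (A : IsArcDecomposition g V a b s) (hg : Continuous g) (i : ι) :
    ∃ f : C(G, AddCircle (1 : ℝ)), (∀ c ∈ Set.Ioo (a i) (b i),
      f (s i c) = ((c - a i) / (b i - a i) : ℝ)) ∧
      ∀ x ∉ s i '' Set.Ioo (a i) (b i), f x = 0 := by
  classical
  have hne : b i - a i ≠ 0 := (sub_pos.2 (A.lt i)).ne'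
  refine ⟨⟨fun x => if x ∈ s i '' Set.Ioo (a i) (b i) then
    (((g x - a i) / (b i - a i) : ℝ) : AddCircle (1 : ℝ)) else 0, ?_⟩, ?_, ?_⟩
  -- Only the ends of the arc lie on the frontier, and there the quotient is `0` or `1`, both zero
  -- in the circle.
  · refine Continuous.if (fun x hx => ?_) ?_ continuous_const
    · change x ∈ frontier (s i '' Set.Ioo (a i) (b i)) at hx
      rw [(A.isOpen i).frontier_eq] at hx
      obtain ⟨c, hc, rfl⟩ := closure_minimal (Set.image_mono Set.Ioo_subset_Icc_self)
        (A.isClosed_arc i) hx.1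
      rw [A.height i c hc]
      rcases hc.1.eq_or_lt with h1 | h1
      · simp [← h1]
      · rcases hc.2.eq_or_lt with h2 | h2
        · rw [h2, div_self hne]; exact AddCircle.coe_period 1
        · exact (hx.2 (Set.mem_image_of_mem _ ⟨h1, h2⟩)).elim
    · exact (AddCircle.continuous_mk' 1).comp (by fun_prop)
  · intro c hc
    simp only [ContinuousMap.coe_mk]
    rw [if_pos (Set.mem_image_of_mem _ hc), A.height i c (Set.Ioo_subset_Icc_self hc)]
  · intro x hx
    simp only [ContinuousMap.coe_mk]
    rw [if_neg hx]

omit [T2Space G] in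
/-- From the top of an arc one can descend to the root along this arc. -/
lemma exists_descent_along (A : IsArcDecomposition g V a b s) (h : IsDescentSpace g D q) (i : ι) :
    ∃ δ : ℝ → G, ContinuousOn δ (Set.Icc 0 (b i)) ∧ δ 0 = q ∧
      (∀ c ∈ Set.Icc 0 (b i), g (δ c) = c) ∧ ∀ c ∈ Set.Icc (a i) (b i), δ c = s i c := by
  classical
  have hai := A.height i (a i) ⟨le_rfl, (A.lt i).le⟩
  have h0 : 0 ≤ a i := hai ▸ h.height_nonneg _
  obtain ⟨δ, hδ, hq, htop, hg, -⟩ := h.exists_descent (s i (a i))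
  rw [hai] at hδ htop hg
  refine ⟨fun c => if c ≤ a i then δ c else s i c, ?_, by simp only [if_pos h0, hq], ?_, ?_⟩
  · refine ContinuousOn.if (fun c hc => ?_) ?_ ?_
    · have : c = a i := by
        have := hc.2
        rw [show {c | c ≤ a i} = Set.Iic (a i) from rfl, frontier_Iic] at this
        exact this
      rw [this, htop]
    · refine hδ.mono fun c hc => ⟨hc.1.1, ?_⟩
      have := hc.2
      rwa [show {c | c ≤ a i} = Set.Iic (a i) from rfl, closure_Iic] at this
    · refine (A.continuousOn i).mono fun c hc => ⟨?_, hc.1.2⟩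
      have := hc.2
      simp only [not_le] at this
      rwa [show {c | a i < c} = Set.Ioi (a i) from rfl, closure_Ioi] at this
  · intro c hc
    by_cases hca : c ≤ a i
    · simp only [if_pos hca]; exact hg c ⟨hc.1, hca⟩
    · simp only [if_neg hca]; exact A.height i c ⟨(not_le.1 hca).le, hc.2⟩
  · intro c hc
    by_cases hca : c ≤ a i
    · have : c = a i := le_antisymm hca hc.1
      simp only [if_pos hca]
      rw [this, htop]
    · simp only [if_neg hca]

/-- If the path to the top of arc `j` entered the open arc `i`, it would have to follow it upwards
to every height below `b j ≤ b i`. Just below `b j`, however, it runs on arc `j`, which is disjoint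
from arc `i`. -/
lemma notMem_arc_of_descent (A : IsArcDecomposition g V a b s) {i j : ι} (hij : j ≠ i)
    (hle : b j ≤ b i) {δ : ℝ → G} (hδ : ContinuousOn δ (Set.Icc 0 (b j)))
    (hg : ∀ c ∈ Set.Icc 0 (b j), g (δ c) = c) (hδs : ∀ c ∈ Set.Icc (a j) (b j), δ c = s j c)
    {c : ℝ} (hc : c ∈ Set.Icc 0 (b j)) : δ c ∉ s i '' Set.Ioo (a i) (b i) := by
  intro hmem
  have hcio : c ∈ Set.Ioo (a i) (b i) := by
    obtain ⟨c', hc', he⟩ := hmem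
    have := A.height i c' (Set.Ioo_subset_Icc_self hc')
    rw [he, hg c hc] at this
    rwa [this]
  have hcb : c < b j := by
    refine lt_of_le_of_ne hc.2 fun hcb => ?_
    obtain ⟨c', hc', he⟩ := hmem
    refine A.notMem i c' hc' ?_
    rw [he, hcb, hδs _ ⟨(A.lt j).le, le_rfl⟩]
    exact A.top_mem j
  obtain ⟨r, hr1, hr2⟩ := exists_between (max_lt hcb (A.lt j))
  have hcr : c < r := (le_max_left _ _).trans_lt hr1
  have har : a j < r := (le_max_right _ _).trans_lt hr1
  have hsub : Set.Icc c r ⊆ Set.Icc 0 (b j) := Set.Icc_subset_Icc hc.1 hr2.le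
  have h1 : δ r = s i r := A.eq_of_mem
    (fun x hx => ⟨hcio.1.trans_le hx.1, (hx.2.trans_lt hr2).trans_le hle⟩)
    (hδ.mono hsub) (fun r hr => hg r (hsub hr)) ⟨le_rfl, hcr.le⟩ hmem ⟨hcr.le, le_rfl⟩
  have h2 := hδs r ⟨har.le, hr2.le⟩
  exact hij (A.index_eq j i r ⟨har, hr2⟩ r ⟨hcio.1.trans hcr, hr2.trans_le hle⟩
    (h2.symm.trans h1))

/-- The number of forks is at most the first Betti number. -/
lemma card_forks_le (A : IsArcDecomposition g V a b s) (h : IsDescentSpace g D q) :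
    ENat.card (forks b s) ≤ firstBettiNumber G := by
  have hb : ∀ i, 0 ≤ b i := fun i =>
    A.height i (b i) ⟨(A.lt i).le, le_rfl⟩ ▸ h.height_nonneg (s i (b i))
  choose δ hδ hq hg hδs using A.exists_descent_along h
  choose f hf hf0 using A.exists_collapse h.continuous_height
  have hmem : ∀ i (t : I), (t : ℝ) * b i ∈ Set.Icc 0 (b i) := fun i t =>
    ⟨mul_nonneg t.2.1 (hb i), mul_le_of_le_one_left (hb i) t.2.2⟩
  -- `P i` climbs from the root to the top of arc `i` and traverses this arc last.
  let P : ι → C(I, G) := fun i => ⟨fun t => δ i (t * b i),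
    (hδ i).comp_continuous (by fun_prop) (hmem i)⟩
  have hP0 : ∀ i, P i 0 = q := fun i => by simp [P, hq]
  have hP1 : ∀ i, P i 1 = s i (b i) := fun i => by
    simp [P, hδs i (b i) ⟨(A.lt i).le, le_rfl⟩]
  have hself : ∀ i, circleCochain (f i) (pathSimplex (P i)) = 1 := by
    intro i
    have hpos : 0 < b i - a i := sub_pos.2 (A.lt i)
    have h0 : 0 ≤ a i := A.height i (a i) ⟨le_rfl, (A.lt i).le⟩ ▸ h.height_nonneg (s i (a i))
    -- The lift vanishes until the path enters arc `i` and then increases from `0` to `1`.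
    rw [circleCochain_pathSimplex (f i) (P i)
      ⟨fun t => max 0 (((t : ℝ) * b i - a i) / (b i - a i)), by fun_prop⟩]
    · simp only [ContinuousMap.coe_mk, Set.Icc.coe_one, one_mul, div_self hpos.ne',
        Set.Icc.coe_zero, zero_mul, zero_sub]
      rw [max_eq_right zero_le_one, max_eq_left, sub_zero]
      exact div_nonpos_of_nonpos_of_nonneg (by linarith) hpos.le
    · intro t
      simp only [P, ContinuousMap.coe_mk]
      have hc := hmem i t
      set c := (t : ℝ) * b i
      rcases le_or_gt c (a i) with h1 | h1
      · rw [max_eq_left (div_nonpos_of_nonpos_of_nonneg (by linarith) hpos.le), hf0]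
        · rfl
        · rintro ⟨c', hc', he⟩
          have := A.height i c' (Set.Ioo_subset_Icc_self hc')
          rw [he, hg i c hc] at this
          linarith [hc'.1]
      · rw [max_eq_right (div_nonneg (by linarith) hpos.le), hδs i c ⟨h1.le, hc.2⟩]
        rcases hc.2.eq_or_lt with h2 | h2
        · rw [h2, div_self hpos.ne', hf0]
          · exact AddCircle.coe_period 1
          · rintro ⟨c', hc', he⟩
            exact A.notMem i c' hc' (he ▸ A.top_mem i)
        · rw [hf i c ⟨h1, h2⟩]
  have hother : ∀ i j, j ≠ i → b j ≤ b i → circleCochain (f i) (pathSimplex (P j)) = 0 := by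
    intro i j hji hle
    rw [circleCochain_pathSimplex (f i) (P j) (ContinuousMap.const _ 0)]
    · simp
    · intro t
      simp only [P, ContinuousMap.coe_mk]
      rw [hf0 i _ (A.notMem_arc_of_descent hji hle (hδ j) (hg j) (hδs j) (hmem j t))]
      rfl
  have htop : ∀ i, b i = g (s i (b i)) := fun i => (A.height i _ ⟨(A.lt i).le, le_rfl⟩).symm
  choose i j hij hi hj using fun v : forks b s => v.2
  -- The fork `v` carries the loop formed by `P (i v)` and `P (j v)` and the map collapsing the
  -- complement of arc `i v`. Another fork that is not higher has both of its arcs different from `i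
  -- v`, with tops no higher, so its loop pairs to zero.
  refine card_le_firstBettiNumber (fun v : forks b s => g v) (fun v => P (i v)) (fun v => P (j v))
    (fun v => by simp only [hP0]) (fun v => by simp only [hP1, hi, hj]) (fun v => f (i v))
    (fun v => ?_) (fun v w hwv hle => ?_)
  · rw [hself, hother _ _ (hij v).symm (by rw [htop, htop (i v), hi, hj])]
    norm_num
  · have key : ∀ k, s k (b k) = w → circleCochain (f (i v)) (pathSimplex (P k)) = 0 := by
      intro k hk
      refine hother _ _ (fun hkv => hwv (Subtype.ext ?_)) ?_
      · rw [← hk, hkv, hi]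
      · rw [htop, htop (i v), hi, hk]; exact hle
    rw [key _ (hi w), key _ (hj w), sub_zero]

end IsArcDecomposition

/-! ### Extrema and inversion of real functions -/

section RealFunctions

lemma continuousOn_invFunOn_image {α β : Type*} [TopologicalSpace α] [TopologicalSpace β]
    [T2Space β] [Nonempty α] {f : α → β} {K : Set α} (hK : IsCompact K)
    (hf : ContinuousOn f K) (hinj : Set.InjOn f K) :
    ContinuousOn (Function.invFunOn f K) (f '' K) := by
  refine continuousOn_iff_isClosed.2 fun t ht => ⟨f '' (K ∩ t),
    ((hK.inter_right ht).image_of_continuousOn (hf.mono Set.inter_subset_left)).isClosed, ?_⟩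
  ext y
  constructor
  · rintro ⟨hy, x, hx, rfl⟩
    rw [Set.mem_preimage, hinj.leftInvOn_invFunOn hx] at hy
    exact ⟨⟨x, ⟨hx, hy⟩, rfl⟩, x, hx, rfl⟩
  · rintro ⟨⟨x, ⟨hx, hxt⟩, rfl⟩, -⟩
    refine ⟨?_, x, hx, rfl⟩
    rw [Set.mem_preimage, hinj.leftInvOn_invFunOn hx]
    exact hxt

/-- If the minimum over the interval is attained only at an end, this end is also a local maximum,
so `f` takes its minimal value at all nearby interior points as well and one of them serves. -/
lemma exists_isLocalMin_of_isLocalMax {f : ℝ → ℝ} {t₁ t₂ : ℝ} (hlt : t₁ < t₂)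
    (hf : ContinuousOn f (Set.Icc t₁ t₂)) (h₁ : IsLocalMax f t₁) (h₂ : IsLocalMax f t₂) :
    ∃ t ∈ Set.Ioo t₁ t₂, IsLocalMin f t := by
  obtain ⟨m, hm, hmin⟩ := isCompact_Icc.exists_isMinOn (Set.nonempty_Icc.2 hlt.le) hf
  have key : ∀ t ∈ Set.Ioo t₁ t₂, (∀ᶠ t' in nhds t, f t' ≤ f m) → IsLocalMin f t := by
    intro t ht h
    have hle : f t ≤ f m := h.self_of_nhds
    filter_upwards [Icc_mem_nhds ht.1 ht.2] with t' ht'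
    exact hle.trans (hmin ht')
  rcases hm.1.eq_or_lt with rfl | h1
  · obtain ⟨t, h, ht⟩ := ((h₁.eventually_nhds.filter_mono nhdsWithin_le_nhds).and
      (Ioo_mem_nhdsGT hlt)).exists
    exact ⟨t, ht, key t ht h⟩
  rcases hm.2.eq_or_lt with rfl | h2
  · obtain ⟨t, h, ht⟩ := ((h₂.eventually_nhds.filter_mono nhdsWithin_le_nhds).and
      (Ioo_mem_nhdsLT hlt)).exists
    exact ⟨t, ht, key t ht h⟩
  · exact ⟨m, ⟨h1, h2⟩, hmin.isLocalMin (Icc_mem_nhds h1 h2)⟩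

/-- The inverse of `g ∘ φ` is continuous by compactness; composing it with `φ` makes the height the
parameter. -/
lemma exists_height_parametrization_of_strictMonoOn {G : Type*} [TopologicalSpace G]
    {g : G → ℝ} {φ : ℝ → G} {l r : ℝ} (hlr : l < r) (hφ : ContinuousOn φ (Set.Icc l r))
    (hg : Continuous g) (hmono : StrictMonoOn (g ∘ φ) (Set.Icc l r)) :
    ∃ (a b : ℝ) (s : ℝ → G), a < b ∧ ContinuousOn s (Set.Icc a b) ∧
      (∀ c ∈ Set.Icc a b, g (s c) = c) ∧ s '' Set.Ioo a b = φ '' Set.Ioo l r ∧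
      s a = φ l ∧ s b = φ r := by
  have hl : l ∈ Set.Icc l r := ⟨le_rfl, hlr.le⟩
  have hr : r ∈ Set.Icc l r := ⟨hlr.le, le_rfl⟩
  have hcont : ContinuousOn (g ∘ φ) (Set.Icc l r) := hg.comp_continuousOn hφ
  have himg : (g ∘ φ) '' Set.Icc l r = Set.Icc (g (φ l)) (g (φ r)) := by
    refine Set.Subset.antisymm ?_ (intermediate_value_Icc hlr.le hcont)
    rintro _ ⟨t, ht, rfl⟩
    exact ⟨hmono.monotoneOn hl ht ht.1, hmono.monotoneOn ht hr ht.2⟩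
  let ψ := Function.invFunOn (g ∘ φ) (Set.Icc l r)
  have hψ : ∀ t ∈ Set.Icc l r, ψ (g (φ t)) = t := fun t ht =>
    hmono.injOn.leftInvOn_invFunOn ht
  have hψc := continuousOn_invFunOn_image isCompact_Icc hcont hmono.injOn
  rw [himg] at hψc
  have hψm : Set.MapsTo ψ (Set.Icc (g (φ l)) (g (φ r))) (Set.Icc l r) := by
    intro c hc
    rw [← himg] at hc
    obtain ⟨t, ht, rfl⟩ := hc
    simp only [Function.comp_apply, hψ t ht, ht]
  have hψr : ∀ c ∈ Set.Icc (g (φ l)) (g (φ r)), g (φ (ψ c)) = c := by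
    intro c hc
    rw [← himg] at hc
    obtain ⟨t, ht, rfl⟩ := hc
    simp only [Function.comp_apply, hψ t ht]
  refine ⟨g (φ l), g (φ r), φ ∘ ψ, hmono hl hr hlr, hφ.comp hψc hψm, hψr, ?_, ?_, ?_⟩
  · ext x
    constructor
    · rintro ⟨c, hc, rfl⟩
      have hc' := Set.Ioo_subset_Icc_self hc
      have h1 := hψr c hc'
      have h2 := hψm hc'
      refine ⟨ψ c, ⟨lt_of_le_of_ne h2.1 fun he => ?_, lt_of_le_of_ne h2.2 fun he => ?_⟩, rfl⟩
      · rw [← he] at h1; exact hc.1.ne h1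
      · rw [he] at h1; exact hc.2.ne' h1
    · rintro ⟨t, ht, rfl⟩
      have ht' := Set.Ioo_subset_Icc_self ht
      exact ⟨g (φ t), ⟨hmono hl ht' ht.1, hmono ht' hr ht.2⟩, by simp [hψ t ht']⟩
  · simp [hψ l hl]
  · simp [hψ r hr]

/-- An injective continuous height is strictly monotone; if it decreases, the edge is reversed. The
disjunctions leave the orientation open. -/
lemma exists_height_parametrization {G : Type*} [TopologicalSpace G]
    {g : G → ℝ} {φ : ℝ → G} {l r : ℝ} (hlr : l < r) (hφ : ContinuousOn φ (Set.Icc l r))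
    (hg : Continuous g) (hinj : Set.InjOn (g ∘ φ) (Set.Icc l r)) :
    ∃ (a b : ℝ) (s : ℝ → G), a < b ∧ ContinuousOn s (Set.Icc a b) ∧
      (∀ c ∈ Set.Icc a b, g (s c) = c) ∧ s '' Set.Ioo a b = φ '' Set.Ioo l r ∧
      (s a = φ l ∨ s a = φ r) ∧ (s b = φ l ∨ s b = φ r) := by
  rcases (hg.comp_continuousOn hφ).strictMonoOn_of_injOn_Icc' hlr.le hinj with h | h
  · obtain ⟨a, b, s, h1, h2, h3, h4, h5, h6⟩ :=
      exists_height_parametrization_of_strictMonoOn hlr hφ hg h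
    exact ⟨a, b, s, h1, h2, h3, h4, Or.inl h5, Or.inr h6⟩
  · have hmaps : Set.MapsTo (fun t : ℝ => -t) (Set.Icc (-r) (-l)) (Set.Icc l r) := fun t ht =>
      ⟨by linarith [ht.2], by linarith [ht.1]⟩
    obtain ⟨a, b, s, h1, h2, h3, h4, h5, h6⟩ :=
      exists_height_parametrization_of_strictMonoOn (φ := fun t => φ (-t)) (l := -r) (r := -l)
        (neg_lt_neg hlr) (hφ.comp continuous_neg.continuousOn hmaps) hg
        (fun x hx y hy hxy => h (hmaps hy) (hmaps hx) (neg_lt_neg hxy))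
    refine ⟨a, b, s, h1, h2, h3, h4.trans ?_, Or.inr (by simpa using h5),
      Or.inl (by simpa using h6)⟩
    rw [show (fun t => φ (-t)) = φ ∘ Neg.neg from rfl, Set.image_comp, Set.image_neg_eq_neg,
      Set.neg_Ioo, neg_neg, neg_neg]

end RealFunctions

/-! ### Finite graphs with a descending height decompose into arcs -/

/-- A presentation of a space by finitely many vertices and edges `φ e : [-1, 1] → G`. -/
structure IsEdgePresentation {G : Type u} [TopologicalSpace G] (V : Set G) {E : Type*}
    (φ : E → ℝ → G) : Prop where
  finite : V.Finite
  continuousOn : ∀ e, ContinuousOn (φ e) (Set.Icc (-1) 1)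
  injOn : ∀ e, Set.InjOn (φ e) (Set.Ioo (-1) 1)
  bot_mem : ∀ e, φ e (-1) ∈ V
  top_mem : ∀ e, φ e 1 ∈ V
  notMem : ∀ e, ∀ t ∈ Set.Ioo (-1) 1, φ e t ∉ V
  index_eq : ∀ e e', ∀ t ∈ Set.Ioo (-1) 1, ∀ t' ∈ Set.Ioo (-1) 1, φ e t = φ e' t' → e = e'
  cover : ∀ x, x ∈ V ∨ ∃ e, ∃ t ∈ Set.Ioo (-1) 1, φ e t = x

open Topology in
lemma IsFiniteTopologicalGraph.exists_edgePresentation {G : Type u} [TopologicalSpace G]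
    (hG : IsFiniteTopologicalGraph G) :
    ∃ (V : Set G) (E : Type u) (_ : Finite E) (φ : E → ℝ → G), IsEdgePresentation V φ := by
  obtain ⟨hT2, hCW, hfin, hdim⟩ := hG
  have hfin' : Finite (Σ n, RelCWComplex.cell (Set.univ : Set G) n) :=
    RelCWComplex.finite_cells_of_finite (C := (Set.univ : Set G))
  have hfinn : ∀ n, Finite (RelCWComplex.cell (Set.univ : Set G) n) := fun n =>
    Finite.of_injective (fun e => (⟨n, e⟩ : Σ n, RelCWComplex.cell (Set.univ : Set G) n))
      fun e e' h => by simpa using h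
  let φ : RelCWComplex.cell (Set.univ : Set G) 1 → ℝ → G := fun e t =>
    RelCWComplex.map (C := (Set.univ : Set G)) 1 e fun _ => t
  have hball : ∀ t : ℝ, (fun _ : Fin 1 => t) ∈ Metric.ball (0 : Fin 1 → ℝ) 1 ↔
      t ∈ Set.Ioo (-1) 1 := by
    intro t
    rw [mem_ball_zero_iff, pi_norm_const, Real.norm_eq_abs, abs_lt, Set.mem_Ioo]
  have hcball : ∀ t : ℝ, (fun _ : Fin 1 => t) ∈ Metric.closedBall (0 : Fin 1 → ℝ) 1 ↔
      t ∈ Set.Icc (-1) 1 := by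
    intro t
    rw [mem_closedBall_zero_iff, pi_norm_const, Real.norm_eq_abs, abs_le, Set.mem_Icc]
  have hopen : ∀ e, ∀ t ∈ Set.Ioo (-1 : ℝ) 1,
      φ e t ∈ RelCWComplex.openCell (C := (Set.univ : Set G)) 1 e :=
    fun e t ht => Set.mem_image_of_mem _ ((hball t).2 ht)
  have hzero : ∀ j : RelCWComplex.cell (Set.univ : Set G) 0,
      RelCWComplex.openCell (C := (Set.univ : Set G)) 0 j =
        {RelCWComplex.map (C := (Set.univ : Set G)) 0 j ![]} := fun j =>
    RelCWComplex.openCell_zero_eq_singleton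
  let V : Set G := Set.range fun j : RelCWComplex.cell (Set.univ : Set G) 0 =>
    RelCWComplex.map (C := (Set.univ : Set G)) 0 j ![]
  have hends : ∀ e t, ‖t‖ = (1 : ℝ) → φ e t ∈ V := by
    intro e t ht
    obtain ⟨J, hJ⟩ := CWComplex.mapsTo (C := (Set.univ : Set G)) 1 e
    have h1 : (fun _ : Fin 1 => t) ∈ Metric.sphere (0 : Fin 1 → ℝ) 1 := by
      rw [mem_sphere_zero_iff_norm, pi_norm_const, ht]
    have h2 := hJ h1
    simp only [Set.mem_iUnion] at h2
    obtain ⟨m, hm, j, -, hj⟩ := h2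
    obtain rfl : m = 0 := by omega
    change _ ∈ RelCWComplex.closedCell (C := (Set.univ : Set G)) 0 j at hj
    rw [RelCWComplex.closedCell_zero_eq_singleton] at hj
    exact ⟨j, hj.symm⟩
  refine ⟨V, _, hfinn 1, φ, Set.finite_range _, fun e => ?_, fun e t ht t' ht' h => ?_,
    fun e => hends e _ (by simp), fun e => hends e _ (by simp), ?_, ?_, ?_⟩
  · exact (RelCWComplex.continuousOn 1 e).comp (by fun_prop) fun t ht => (hcball t).2 ht
  · have hinj := (RelCWComplex.map (C := (Set.univ : Set G)) 1 e).injOn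
    rw [RelCWComplex.source_eq] at hinj
    exact congrFun (hinj ((hball t).2 ht) ((hball t').2 ht') h) 0
  · rintro e t ht ⟨j, hj⟩
    have hd := CWComplex.disjoint_openCell_of_ne (C := (Set.univ : Set G)) (n := 1) (m := 0)
      (i := e) (j := j) (by intro h; simpa using congrArg Sigma.fst h)
    refine Set.disjoint_left.1 hd (hopen e t ht) ?_
    rw [hzero, ← hj]
    rfl
  · intro e e' t ht t' ht' h
    have := RelCWComplex.eq_of_not_disjoint_openCell (C := (Set.univ : Set G)) (j := e) (i := e')
      (Set.not_disjoint_iff.2 ⟨_, hopen e t ht, h ▸ hopen e' t' ht'⟩)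
    simpa using this
  · intro x
    have hx : x ∈ ⋃ (n : ℕ) (j : RelCWComplex.cell (Set.univ : Set G) n),
        RelCWComplex.openCell (C := (Set.univ : Set G)) n j := by
      rw [CWComplex.iUnion_openCell_eq_complex]; trivial
    simp only [Set.mem_iUnion] at hx
    obtain ⟨n, j, hj⟩ := hx
    match n, j, hj with
    | 0, j, hj => rw [hzero] at hj; exact Or.inl ⟨j, hj.symm⟩
    | 1, j, ⟨w, hw, hwx⟩ =>
      have hw' : w = fun _ => w 0 := by ext i; rw [Subsingleton.elim i 0]
      exact Or.inr ⟨j, w 0, (hball _).1 (hw' ▸ hw), by rw [← hwx, hw']⟩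
    | n + 2, j, _ => exact (hdim (n + 2) (by omega)).elim j

namespace IsEdgePresentation

variable {G : Type u} [TopologicalSpace G] [T2Space G] {V : Set G} {E : Type v} {φ : E → ℝ → G}

/-- The complement is a finite union of compact sets: the vertices, the other closed edges and the
rest of this edge. -/
lemma isOpen_image [Finite E] (P : IsEdgePresentation V φ) (e : E) {U : Set ℝ} (hU : IsOpen U)
    (hUI : U ⊆ Set.Ioo (-1) 1) : IsOpen (φ e '' U) := by
  have hcl : IsClosed ((V ∪ ⋃ e' : {e' // e' ≠ e}, φ e' '' Set.Icc (-1) 1) ∪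
      φ e '' (Set.Icc (-1) 1 \ U)) := by
    refine (P.finite.isClosed.union (isClosed_iUnion_of_finite fun e' => ?_)).union ?_
    · exact (isCompact_Icc.image_of_continuousOn (P.continuousOn e')).isClosed
    · exact ((isCompact_Icc.diff hU).image_of_continuousOn
        ((P.continuousOn e).mono Set.sdiff_subset)).isClosed
  have hcase : ∀ e, ∀ t ∈ Set.Icc (-1 : ℝ) 1, t ∈ Set.Ioo (-1) 1 ∨ φ e t ∈ V := by
    intro e t ht
    rcases ht.1.eq_or_lt with h1 | h1
    · exact Or.inr (h1 ▸ P.bot_mem e)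
    · rcases ht.2.eq_or_lt with h2 | h2
      · exact Or.inr (h2 ▸ P.top_mem e)
      · exact Or.inl ⟨h1, h2⟩
  convert hcl.isOpen_compl using 1
  ext x
  constructor
  · rintro ⟨t, ht, rfl⟩ ((h | h) | ⟨t', ht', h⟩)
    · exact P.notMem e t (hUI ht) h
    · obtain ⟨e', t', ht', h⟩ := Set.mem_iUnion.1 h
      rcases hcase e' t' ht' with h1 | h1
      · exact e'.2 (P.index_eq _ _ t' h1 t (hUI ht) h)
      · exact P.notMem e t (hUI ht) (h ▸ h1)
    · rcases hcase e t' ht'.1 with h1 | h1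
      · exact ht'.2 (P.injOn e h1 (hUI ht) h ▸ ht)
      · exact P.notMem e t (hUI ht) (h ▸ h1)
  · intro hx
    rcases P.cover x with h | ⟨e', t, ht, rfl⟩
    · exact (hx (Or.inl (Or.inl h))).elim
    · by_cases he : e' = e
      · subst he
        by_cases htU : t ∈ U
        · exact ⟨t, htU, rfl⟩
        · exact (hx (Or.inr ⟨t, ⟨Set.Ioo_subset_Icc_self ht, htU⟩, rfl⟩)).elim
      · exact (hx (Or.inl (Or.inr (Set.mem_iUnion.2
          ⟨⟨e', he⟩, t, Set.Ioo_subset_Icc_self ht, rfl⟩)))).elim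

lemma isLocalMin_of_comp [Finite E] (P : IsEdgePresentation V φ) {g : G → ℝ} {e : E} {t : ℝ}
    (ht : t ∈ Set.Ioo (-1) 1) (h : IsLocalMin (g ∘ φ e) t) : IsLocalMin g (φ e t) := by
  obtain ⟨U, hU, hUo, htU⟩ := mem_nhds_iff.1 (Filter.inter_mem h (isOpen_Ioo.mem_nhds ht))
  refine Filter.mem_of_superset ((P.isOpen_image e hUo fun x hx => (hU hx).2).mem_nhds
    (Set.mem_image_of_mem _ htU)) ?_
  rintro _ ⟨t', ht', rfl⟩
  exact (hU ht').1

lemma isLocalMax_of_comp [Finite E] (P : IsEdgePresentation V φ) {g : G → ℝ} {e : E} {t : ℝ}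
    (ht : t ∈ Set.Ioo (-1) 1) (h : IsLocalMax (g ∘ φ e) t) : IsLocalMax g (φ e t) := by
  have := P.isLocalMin_of_comp (g := fun x => - g x) ht h.neg
  simpa using this.neg

variable {g : G → ℝ} {D : G → G → ℝ} {q : G}

-- At positive height the descent from `x` contains points arbitrarily close to `x` and strictly
-- lower.
omit [T2Space G] in
lemma _root_.IsDescentSpace.eq_root_of_isLocalMin (h : IsDescentSpace g D q) {x : G}
    (hx : IsLocalMin g x) : x = q := by
  obtain ⟨δ, hδ, h0, htop, hg, -⟩ := h.exists_descent x
  rcases (h.height_nonneg x).eq_or_lt with h1 | h1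
  · rw [← htop, ← h1, h0]
  exfalso
  have htend : Filter.Tendsto δ (nhdsWithin (g x) (Set.Ioo 0 (g x))) (nhds x) := by
    have := hδ (g x) ⟨h1.le, le_rfl⟩
    rw [ContinuousWithinAt, htop] at this
    exact this.mono_left (nhdsWithin_mono _ Set.Ioo_subset_Icc_self)
  have hne : (nhdsWithin (g x) (Set.Ioo 0 (g x))).NeBot := by
    rw [nhdsWithin_Ioo_eq_nhdsLT h1]; infer_instance
  obtain ⟨c, hc, hcI⟩ := ((htend.eventually hx).and self_mem_nhdsWithin).exists
  rw [hg c (Set.Ioo_subset_Icc_self hcI)] at hc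
  exact absurd hcI.2 (not_lt.2 hc)

/-- Between two local maxima on an edge lies a local minimum, which must be the root. The interior
of the edge meets the root at most once, so there is at most one local maximum on either side of it.
-/
lemma finite_isLocalMax [Finite E] (P : IsEdgePresentation V φ) (h : IsDescentSpace g D q)
    (e : E) : {t | t ∈ Set.Ioo (-1 : ℝ) 1 ∧ IsLocalMax g (φ e t)}.Finite := by
  set M := {t | t ∈ Set.Ioo (-1 : ℝ) 1 ∧ IsLocalMax g (φ e t)}
  have hbetween : ∀ t₁ ∈ M, ∀ t₂ ∈ M, t₁ < t₂ → ∃ t ∈ Set.Ioo t₁ t₂, φ e t = q := by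
    intro t₁ h₁ t₂ h₂ hlt
    have hsub : Set.Icc t₁ t₂ ⊆ Set.Ioo (-1) 1 := fun t ht =>
      ⟨h₁.1.1.trans_le ht.1, ht.2.trans_lt h₂.1.2⟩
    have hloc : ∀ t ∈ M, IsLocalMax (g ∘ φ e) t := fun t ht =>
      IsMaxFilter.comp_tendsto ht.2 ((P.continuousOn e).continuousAt (Icc_mem_nhds ht.1.1 ht.1.2))
    obtain ⟨t, ht, hmin⟩ := exists_isLocalMin_of_isLocalMax hlt
      (h.continuous_height.comp_continuousOn ((P.continuousOn e).mono (hsub.trans Set.Ioo_subset_Icc_self))) (hloc _ h₁) (hloc _ h₂)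
    exact ⟨t, ht, h.eq_root_of_isLocalMin
      (P.isLocalMin_of_comp (hsub (Set.Ioo_subset_Icc_self ht)) hmin)⟩
  by_cases hz : ∃ z ∈ Set.Ioo (-1 : ℝ) 1, φ e z = q
  · obtain ⟨z, hz, hzq⟩ := hz
    have hzb : ∀ t₁ ∈ M, ∀ t₂ ∈ M, t₁ < t₂ → t₁ < z ∧ z < t₂ := by
      intro t₁ h₁ t₂ h₂ hlt
      obtain ⟨t, ht, htq⟩ := hbetween t₁ h₁ t₂ h₂ hlt
      obtain rfl : t = z := P.injOn e ⟨h₁.1.1.trans ht.1, ht.2.trans h₂.1.2⟩ hz (htq.trans hzq.symm)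
      exact ht
    have hl : (M ∩ Set.Iic z).Subsingleton := by
      intro x hx y hy
      by_contra hxy
      rcases lt_or_gt_of_ne hxy with hlt | hlt
      · exact absurd (hzb _ hx.1 _ hy.1 hlt).2 (not_lt.2 hy.2)
      · exact absurd (hzb _ hy.1 _ hx.1 hlt).2 (not_lt.2 hx.2)
    have hr : (M ∩ Set.Ici z).Subsingleton := by
      intro x hx y hy
      by_contra hxy
      rcases lt_or_gt_of_ne hxy with hlt | hlt
      · exact absurd (hzb _ hx.1 _ hy.1 hlt).1 (not_lt.2 hx.2)
      · exact absurd (hzb _ hy.1 _ hx.1 hlt).1 (not_lt.2 hy.2)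
    refine (hl.finite.union hr.finite).subset fun t ht => ?_
    rcases le_total t z with h' | h'
    · exact Or.inl ⟨ht, h'⟩
    · exact Or.inr ⟨ht, h'⟩
  · refine Set.Subsingleton.finite fun x hx y hy => ?_
    by_contra hxy
    rcases lt_or_gt_of_ne hxy with hlt | hlt
    · obtain ⟨t, ht, htq⟩ := hbetween x hx y hy hlt
      exact hz ⟨t, ⟨hx.1.1.trans ht.1, ht.2.trans hy.1.2⟩, htq⟩
    · obtain ⟨t, ht, htq⟩ := hbetween y hy x hx hlt
      exact hz ⟨t, ⟨hy.1.1.trans ht.1, ht.2.trans hx.1.2⟩, htq⟩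

/-- A finite graph with a descending height function decomposes into arcs parametrized by
height. -/
lemma exists_arcDecomposition [Finite E] (P : IsEdgePresentation V φ)
    (h : IsDescentSpace g D q) :
    ∃ (V' : Set G) (ι : Type v) (_ : Finite ι) (a b : ι → ℝ) (s : ι → ℝ → G),
      V'.Finite ∧ IsArcDecomposition g V' a b s := by
  -- Adding the root and all local maxima inside edges to the vertices leaves no extremum of the
  -- height between consecutive cut points, so the height is injective there.
  let V' : Set G := V ∪ {q} ∪
    ⋃ e, φ e '' {t | t ∈ Set.Ioo (-1 : ℝ) 1 ∧ IsLocalMax g (φ e t)}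
  have hV' : V'.Finite := (P.finite.union (Set.finite_singleton q)).union
    (Set.finite_iUnion fun e => (P.finite_isLocalMax h e).image _)
  have hVV' : V ⊆ V' := fun x hx => Or.inl (Or.inl hx)
  let T : E → Set ℝ := fun e => {t | t ∈ Set.Icc (-1 : ℝ) 1 ∧ φ e t ∈ V'}
  have hbot : ∀ e, -1 ∈ T e := fun e => ⟨by norm_num, hVV' (P.bot_mem e)⟩
  have htop : ∀ e, 1 ∈ T e := fun e => ⟨by norm_num, hVV' (P.top_mem e)⟩
  have hT : ∀ e, (T e).Finite := by
    intro e
    refine ((Set.toFinite {-1, 1}).union (hV'.preimage (f := (Set.Ioo (-1 : ℝ) 1).domRestrict (φ e))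
      ((Set.injOn_iff_injective.1 (P.injOn e)).injOn) |>.image Subtype.val)).subset fun t ht => ?_
    rcases ht.1.1.eq_or_lt with h1 | h1
    · exact Or.inl (Or.inl h1.symm)
    · rcases ht.1.2.eq_or_lt with h2 | h2
      · exact Or.inl (Or.inr h2)
      · exact Or.inr ⟨⟨t, h1, h2⟩, ht.2, rfl⟩
  -- An arc is an edge with two consecutive cut parameters on it.
  let ι : Type v := {x : E × ℝ × ℝ // x.2.1 ∈ T x.1 ∧ x.2.2 ∈ T x.1 ∧ x.2.1 < x.2.2 ∧
    ∀ t ∈ Set.Ioo x.2.1 x.2.2, t ∉ T x.1}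
  have hι : Finite ι := by
    have hTT : (⋃ e, T e).Finite := Set.finite_iUnion hT
    refine Set.Finite.subset (Set.finite_univ.prod (hTT.prod hTT)) fun x hx =>
      ⟨Set.mem_univ _, Set.mem_iUnion.2 ⟨_, hx.1⟩, Set.mem_iUnion.2 ⟨_, hx.2.1⟩⟩
  have hIcc : ∀ i : ι, Set.Icc i.1.2.1 i.1.2.2 ⊆ Set.Icc (-1) 1 := fun i =>
    Set.Icc_subset_Icc i.2.1.1.1 i.2.2.1.1.2
  have hIoo : ∀ i : ι, Set.Ioo i.1.2.1 i.1.2.2 ⊆ Set.Ioo (-1) 1 := fun i =>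
    Set.Ioo_subset_Ioo i.2.1.1.1 i.2.2.1.1.2
  have hinj : ∀ i : ι, Set.InjOn (g ∘ φ i.1.1) (Set.Icc i.1.2.1 i.1.2.2) := by
    intro i
    have key : ∀ x ∈ Set.Icc i.1.2.1 i.1.2.2, ∀ y ∈ Set.Icc i.1.2.1 i.1.2.2, x < y →
        (g ∘ φ i.1.1) x ≠ (g ∘ φ i.1.1) y := by
      intro x hx y hy hxy he
      have hsub : Set.Icc x y ⊆ Set.Icc (-1) 1 :=
        (Set.Icc_subset_Icc hx.1 hy.2).trans (hIcc i)
      obtain ⟨t, ht, hext⟩ := exists_isLocalExtr_Ioo hxy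
        (h.continuous_height.comp_continuousOn ((P.continuousOn i.1.1).mono hsub)) he
      have htI : t ∈ Set.Ioo i.1.2.1 i.1.2.2 := ⟨hx.1.trans_lt ht.1, ht.2.trans_le hy.2⟩
      have ht1 := hIoo i htI
      refine i.2.2.2.2 t htI ⟨Set.Ioo_subset_Icc_self ht1, ?_⟩
      rcases hext with hmin | hmax
      · exact Or.inl (Or.inr (h.eq_root_of_isLocalMin (P.isLocalMin_of_comp ht1 hmin)))
      · exact Or.inr (Set.mem_iUnion.2 ⟨_, t, ⟨ht1, P.isLocalMax_of_comp ht1 hmax⟩, rfl⟩)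
    intro x hx y hy he
    by_contra hxy
    rcases lt_or_gt_of_ne hxy with hlt | hlt
    · exact key x hx y hy hlt he
    · exact key y hy x hx hlt he.symm
  choose a b s hab hs hheight himage hbots htops using fun i : ι =>
    exists_height_parametrization i.2.2.2.1 ((P.continuousOn i.1.1).mono (hIcc i))
      h.continuous_height (hinj i)
  have hmem : ∀ i, ∀ c ∈ Set.Ioo (a i) (b i), ∃ t ∈ Set.Ioo i.1.2.1 i.1.2.2, φ i.1.1 t = s i c :=
    fun i c hc => by
      have : s i c ∈ φ i.1.1 '' Set.Ioo i.1.2.1 i.1.2.2 := himage i ▸ Set.mem_image_of_mem _ hc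
      exact this
  refine ⟨V', ι, hι, a, b, s, hV', hab, hs, hheight, fun i => ?_, fun i => ?_, fun i => ?_,
    ?_, ?_, ?_⟩
  · rw [himage]
    exact P.isOpen_image _ isOpen_Ioo (hIoo i)
  · rcases hbots i with h1 | h1 <;> rw [h1]
    exacts [i.2.1.2, i.2.2.1.2]
  · rcases htops i with h1 | h1 <;> rw [h1]
    exacts [i.2.1.2, i.2.2.1.2]
  · intro i c hc hV
    obtain ⟨t, ht, he⟩ := hmem i c hc
    exact i.2.2.2.2 t ht ⟨Set.Ioo_subset_Icc_self (hIoo i ht), he ▸ hV⟩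
  · intro i j c hc c' hc' he
    obtain ⟨t, ht, h1⟩ := hmem i c hc
    obtain ⟨t', ht', h2⟩ := hmem j c' hc'
    obtain ⟨⟨e, l, r⟩, hl, hr, hlr, hgap⟩ := i
    obtain ⟨⟨e', l', r'⟩, hl', hr', hlr', hgap'⟩ := j
    simp only at ht ht' h1 h2 hl hr hlr hgap hl' hr' hlr' hgap'
    have hti := Set.Ioo_subset_Ioo hl.1.1 hr.1.2 ht
    have htj := Set.Ioo_subset_Ioo hl'.1.1 hr'.1.2 ht'
    have heq : φ e t = φ e' t' := by rw [h1, h2, he]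
    obtain rfl : e = e' := P.index_eq _ _ t hti t' htj heq
    obtain rfl : t = t' := P.injOn e hti htj heq
    have e1 : l = l' := le_antisymm
      (not_lt.1 fun hlt => hgap' l ⟨hlt, ht.1.trans ht'.2⟩ hl)
      (not_lt.1 fun hlt => hgap l' ⟨hlt, ht'.1.trans ht.2⟩ hl')
    have e2 : r = r' := le_antisymm
      (not_lt.1 fun hlt => hgap r' ⟨ht.1.trans ht'.2, hlt⟩ hr')
      (not_lt.1 fun hlt => hgap' r ⟨ht'.1.trans ht.2, hlt⟩ hr)
    subst e1 e2
    rfl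
  · intro x
    by_cases hx : x ∈ V'
    · exact Or.inl hx
    right
    rcases P.cover x with hxV | ⟨e, t, ht, rfl⟩
    · exact absurd (hVV' hxV) hx
    obtain ⟨l, ⟨hl, hlt⟩, hlmax⟩ := Set.exists_max_image (T e ∩ Set.Iic t) id
      ((hT e).inter_of_left _) ⟨-1, hbot e, ht.1.le⟩
    obtain ⟨r, ⟨hr, hrt⟩, hrmin⟩ := Set.exists_min_image (T e ∩ Set.Ici t) id
      ((hT e).inter_of_left _) ⟨1, htop e, ht.2.le⟩
    simp only [id] at hlmax hrmin
    have hlt' : l < t := lt_of_le_of_ne hlt fun he => hx (he ▸ hl.2)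
    have hrt' : t < r := lt_of_le_of_ne hrt fun he => hx (he ▸ hr.2)
    let i : ι := ⟨⟨e, l, r⟩, hl, hr, hlt'.trans hrt', fun t' ht' hT' => by
      rcases le_total t' t with h1 | h1
      · exact absurd (hlmax t' ⟨hT', h1⟩) (not_le.2 ht'.1)
      · exact absurd (hrmin t' ⟨hT', h1⟩) (not_le.2 ht'.2)⟩
    have : φ e t ∈ s i '' Set.Ioo (a i) (b i) := by
      rw [himage]
      exact Set.mem_image_of_mem _ (show t ∈ Set.Ioo l r from ⟨hlt', hrt'⟩)
    obtain ⟨c, hc, he⟩ := this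
    exact ⟨i, c, hc, he⟩

end IsEdgePresentation

/-! ### Comparison of the Reeb distances along corresponding paths -/

lemma eVariationOn_Iic_add_Icc_le (u : I → ℝ) {a b : I} (hab : a ≤ b) :
    eVariationOn u (Set.Iic a) + edist (u a) (u b) ≤ eVariationOn u (Set.Iic b) := by
  have h := eVariationOn.union u (s := Set.Iic a) (t := Set.Icc a b) (x := a)
    ⟨Set.mem_Iic.2 le_rfl, fun _ h => h⟩ ⟨⟨le_rfl, hab⟩, fun _ h => h.1⟩
  rw [Set.Iic_union_Icc_eq_Iic hab] at h
  rw [h]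
  gcongr
  exact eVariationOn.edist_le u ⟨le_rfl, hab⟩ ⟨hab, le_rfl⟩

/-- In a Reeb graph that is a finite graph, the distance of two points is bounded by the variation
of any function close to the height along a path between them, up to an error controlled by the
first Betti number. -/
lemma exists_reebEDist_le_of_path {Y : Type v} [PseudoMetricSpace Y] [GeodesicSpace Y] (q : Y)
    (hq : IsFiniteTopologicalGraph (ReebGraph q)) :
    ∃ k : ℕ, (k : ℕ∞) ≤ firstBettiNumber (ReebGraph q) ∧
      ∀ (y y' : Y) (β : Path y y') (u : I → ℝ) (ε : ℝ), 0 ≤ ε →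
        (∀ t, |u t - dist q (β t)| ≤ ε) → eVariationOn u Set.univ ≠ ⊤ →
        (reebEDist (fun z => dist q z) y y').toReal ≤
          (eVariationOn u Set.univ).toReal + 4 * (k + 1) * ε := by
  have hT2 : T2Space (ReebGraph q) := hq.1
  have h := isDescentSpace_reebGraph q
  obtain ⟨V, E, hE, φ, P⟩ := hq.exists_edgePresentation
  obtain ⟨V', ι, hι, a, b, s, hV', A⟩ := P.exists_arcDecomposition h
  have hfin : (IsArcDecomposition.forks b s).Finite := hV'.subset A.forks_subset
  refine ⟨hfin.toFinset.card, ?_, fun y y' β u ε hε hclose hvar => ?_⟩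
  · refine le_trans (le_of_eq ?_) (A.card_forks_le h)
    change _ = Set.encard _
    rw [hfin.encard_eq_coe_toFinset_card]
  -- The variation of `u` up to `r`, clamped to the unit interval so that it is monotone on the
  -- whole line. It dominates the increments of `u`, and those of the height up to `2 * ε`.
  let W : ℝ → ℝ := fun r => (eVariationOn u (Set.Iic (Set.projIcc 0 1 zero_le_one r))).toReal
  have htop : ∀ S, eVariationOn u S ≠ ⊤ := fun S =>
    ne_top_of_le_ne_top hvar (eVariationOn.mono u (Set.subset_univ S))
  have hWmono : Monotone W := fun r r' hrr => ENNReal.toReal_mono (htop _)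
    (eVariationOn.mono u (Set.Iic_subset_Iic.2 (Set.monotone_projIcc _ hrr)))
  let δ := β.map (continuous_quotient_mk' (s := reebSetoid fun x : Y => dist q x))
  have hδ : ∀ r ∈ Set.Icc (0 : ℝ) 1, ∃ t : I, (t : ℝ) = r ∧
      Set.projIcc 0 1 zero_le_one r = t ∧ reebHeight q (δ.extend r) = dist q (β t) := by
    intro r hr
    refine ⟨⟨r, hr⟩, rfl, Set.projIcc_of_mem _ hr, ?_⟩
    rw [δ.extend_apply hr]
    rfl
  have key := h.dist_le_of_path (b := δ.extend) δ.continuous_extend hWmono hε hfin.toFinset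
    (fun x hx => hfin.mem_toFinset.2 (A.mem_forks_of_not_isRegularPoint hV' h hx))
    zero_le_one (fun r r' h0 hrr h1 => by
      obtain ⟨t, ht, htp, htg⟩ := hδ r ⟨h0, hrr.trans h1⟩
      obtain ⟨t', ht', htp', htg'⟩ := hδ r' ⟨h0.trans hrr, h1⟩
      have htt : t ≤ t' := Subtype.coe_le_coe.1 (by rw [ht, ht']; exact hrr)
      have hle := ENNReal.toReal_mono (htop _) (eVariationOn_Iic_add_Icc_le u htt)
      rw [ENNReal.toReal_add (htop _) (edist_ne_top _ _), edist_dist,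
        ENNReal.toReal_ofReal dist_nonneg, Real.dist_eq] at hle
      simp only [W, htp, htp', htg, htg']
      have e1 := abs_le.1 (hclose t)
      have e2 := abs_le.1 (hclose t')
      have e3 := abs_le.1 (show |u t - u t'| ≤ _ from le_sub_iff_add_le'.2 hle)
      exact abs_le.2 ⟨by linarith [e1.1, e1.2, e2.1, e2.2, e3.1, e3.2],
        by linarith [e1.1, e1.2, e2.1, e2.2, e3.1, e3.2]⟩)
  rw [δ.extend_zero, δ.extend_one] at key
  have h0 : 0 ≤ W 0 := ENNReal.toReal_nonneg
  have h1 : W 1 ≤ (eVariationOn u Set.univ).toReal :=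
    ENNReal.toReal_mono hvar (eVariationOn.mono u (Set.subset_univ _))
  change (reebEDist (fun z => dist q z) y y').toReal ≤ _ at key
  linarith

/-- For an almost minimal `α` with partner `β`, the bound `hK` is applied to `u = d(p, α)`, whose
variation is almost the distance in the Reeb graph of `p`. -/
lemma reebEDist_toReal_le {X : Type u} {Y : Type v} [PseudoMetricSpace X] [PseudoMetricSpace Y]
    [GeodesicSpace X] [GeodesicSpace Y] {p : X} {q : Y} {R : X → Y → Prop} {ε K : ℝ} (hε : 0 ≤ ε)
    (hR : ∀ x y, R x y → |dist p x - dist q y| ≤ ε) {x x' : X} {y y' : Y}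
    (hpath : ∀ α : Path x x', ∃ β : Path y y', ∀ t, R (α t) (β t))
    (hK : ∀ (β : Path y y') (u : I → ℝ) (ε : ℝ), 0 ≤ ε →
        (∀ t, |u t - dist q (β t)| ≤ ε) → eVariationOn u Set.univ ≠ ⊤ →
        (reebEDist (fun z => dist q z) y y').toReal ≤ (eVariationOn u Set.univ).toReal + K * ε) :
    (reebEDist (fun z => dist q z) y y').toReal ≤
      (reebEDist (fun z => dist p z) x x').toReal + K * ε := by
  refine le_of_forall_pos_le_add fun η hη => ?_
  have hlt : reebEDist (fun z => dist p z) x x' <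
      reebEDist (fun z => dist p z) x x' + ENNReal.ofReal η :=
    ENNReal.lt_add_right (reebEDist_ne_top p x x') (ENNReal.ofReal_pos.2 hη).ne'
  obtain ⟨α, hα⟩ := iInf_lt_iff.1 hlt
  obtain ⟨β, hβ⟩ := hpath α
  have hfin : reebEDist (fun z => dist p z) x x' + ENNReal.ofReal η ≠ ⊤ :=
    ENNReal.add_ne_top.2 ⟨reebEDist_ne_top p x x', ENNReal.ofReal_ne_top⟩
  have h1 := hK β (fun t => dist p (α t)) ε hε (fun t => hR _ _ (hβ t)) hα.ne_top
  have h2 := ENNReal.toReal_mono hfin hα.le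
  rw [ENNReal.toReal_add (reebEDist_ne_top p x x') ENNReal.ofReal_ne_top,
    ENNReal.toReal_ofReal hη.le] at h2
  change (eVariationOn _ _).toReal ≤ _ at h2
  linarith

lemma abs_dist_sub_dist_le_distortion {X : Type u} {Y : Type v} [PseudoMetricSpace X]
    [PseudoMetricSpace Y] {R : X → Y → Prop} (hfin : distortion R ≠ ⊤) {x x' : X} {y y' : Y}
    (h : R x y) (h' : R x' y') : |dist x x' - dist y y'| ≤ (distortion R).toReal := by
  refine (ENNReal.ofReal_le_iff_le_toReal hfin).1 ?_
  exact le_iSup_of_le x (le_iSup_of_le y (le_iSup_of_le h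
    (le_iSup_of_le x' (le_iSup_of_le y' (le_iSup_of_le h' le_rfl)))))

/-- An infimum over no paths would be infinite. -/
lemma nonempty_path {X : Type u} [PseudoMetricSpace X] [GeodesicSpace X] (x y : X) :
    Nonempty (Path x y) := by
  by_contra h
  rw [not_nonempty_iff] at h
  exact reebEDist_ne_top x x y (iInf_of_empty _)

theorem mainTheorem3 {X : Type u} {Y : Type v}
    [MetricSpace X] [CompactSpace X] [GeodesicSpace X]
    [MetricSpace Y] [CompactSpace Y] [GeodesicSpace Y]
    (p : X) (q : Y)
    (hp : IsFiniteTopologicalGraph (ReebGraph p))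
    (hq : IsFiniteTopologicalGraph (ReebGraph q))
    (β : ℕ∞) (hβ : β = max (firstBettiNumber (ReebGraph p)) (firstBettiNumber (ReebGraph q))) :
    gromovHausdorffDist (ReebMetricGraph p) (ReebMetricGraph q) ≤
      (8 * (β : ℝ≥0∞) + 6) * lengthGromovHausdorffDist p q := by
  obtain ⟨k, hk, hkp⟩ := exists_reebEDist_le_of_path p hp
  obtain ⟨l, hl, hlq⟩ := exists_reebEDist_le_of_path q hq
  let n : ℕ := max k l
  have hn : ((n : ℕ) : ℝ≥0∞) ≤ (β : ℝ≥0∞) := by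
    have : (n : ℕ∞) ≤ β := by
      rw [hβ]
      simp only [n]
      exact max_le_max hk hl
    have h2 := ENat.toENNReal_le.2 this
    simpa using h2
  -- The argument yields the constant `4 * n + 4`, where `n` bounds the number of forks of both
  -- graphs. It is finite by construction, so it can be moved into the infimum over `R`.
  have hc : (4 * ((n : ℕ) : ℝ≥0∞) + 4) ≤ 8 * (β : ℝ≥0∞) + 6 := by
    gcongr <;> norm_num
  have hcfin : (4 * ((n : ℕ) : ℝ≥0∞) + 4) ≠ ⊤ := by finiteness
  refine le_trans ?_ (mul_le_mul_left hc _)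
  rw [gromovHausdorffDist, lengthGromovHausdorffDist, ← mul_div_assoc]
  refine ENNReal.div_le_div_right ?_ 2
  rw [ENNReal.mul_iInf_of_ne (by simp) hcfin]
  refine le_iInf fun R => ?_
  by_cases hR : IsPointedPathCorrespondence p q R
  swap
  · rw [iInf_neg hR, ENNReal.mul_top (by simp)]
    exact le_top
  rw [iInf_pos hR]
  by_cases hfin : distortion R = ⊤
  · rw [hfin, ENNReal.mul_top (by simp)]
    exact le_top
  obtain ⟨-, R₀, ⟨⟨hR₀, hsub⟩, hpath⟩, hpq⟩ := hR
  set ε := (distortion R).toReal with hεdef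
  have hε : 0 ≤ ε := ENNReal.toReal_nonneg
  -- The image of `R₀` rather than of `R`: only pairs in `R₀` may serve as ends of corresponding
  -- paths.
  let R' : ReebMetricGraph p → ReebMetricGraph q → Prop := fun a b =>
    ∃ x y, R₀ x y ∧ a = (Quotient.mk _ x : ReebGraph p) ∧ b = (Quotient.mk _ y : ReebGraph q)
  have hR' : IsCorrespondence R' := by
    constructor
    · intro a
      obtain ⟨x, rfl⟩ := Quotient.exists_rep (show ReebGraph p from a)
      obtain ⟨y, hy⟩ := hR₀.1 x
      exact ⟨(Quotient.mk _ y : ReebGraph q), x, y, hy, rfl, rfl⟩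
    · intro b
      obtain ⟨y, rfl⟩ := Quotient.exists_rep (show ReebGraph q from b)
      obtain ⟨x, hx⟩ := hR₀.2 y
      exact ⟨(Quotient.mk _ x : ReebGraph p), x, y, hx, rfl, rfl⟩
  refine iInf₂_le_of_le R' hR' ?_
  refine iSup_le fun a => iSup_le fun b => iSup_le fun hab => iSup_le fun a' => iSup_le fun b' =>
    iSup_le fun hab' => ?_
  obtain ⟨x, y, hxy, rfl, rfl⟩ := hab
  obtain ⟨x', y', hxy', rfl, rfl⟩ := hab'
  -- Here `p R₀ q` enters: the distortion at the pair `(p, q)` compares the heights of corresponding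
  -- points.
  have hclose : ∀ x y, R x y → |dist p x - dist q y| ≤ ε := fun x y h =>
    abs_dist_sub_dist_le_distortion hfin (hsub _ _ hpq) h
  -- The path property takes a path on either side at once; where only one is to be transferred, an
  -- arbitrary one fills the other place.
  obtain ⟨α₀⟩ := nonempty_path x x'
  obtain ⟨β₀⟩ := nonempty_path y y'
  have h1 := reebEDist_toReal_le (K := 4 * (l + 1)) hε hclose
    (fun α => by
      obtain ⟨-, β', hβ', -⟩ := hpath x x' y y' hxy hxy' α β₀
      exact ⟨β', hβ'⟩) (hlq y y')
  have h2 := reebEDist_toReal_le (p := q) (q := p) (R := fun y x => R x y) (K := 4 * (k + 1)) hε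
    (fun y x h => by rw [abs_sub_comm]; exact hclose x y h)
    (fun β' => by
      obtain ⟨α', -, -, hα'⟩ := hpath x x' y y' hxy hxy' α₀ β'
      exact ⟨α', hα'⟩) (hkp x x')
  have hln : (l : ℝ) ≤ n := by exact_mod_cast le_max_right k l
  have hkn : (k : ℝ) ≤ n := by exact_mod_cast le_max_left k l
  have hbound : |(reebEDist (fun z => dist p z) x x').toReal -
      (reebEDist (fun z => dist q z) y y').toReal| ≤ (4 * n + 4) * ε :=
    abs_le.2 ⟨by nlinarith, by nlinarith⟩
  refine (ENNReal.ofReal_le_ofReal hbound).trans (le_of_eq ?_)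
  rw [ENNReal.ofReal_mul (by positivity), hεdef, ENNReal.ofReal_toReal hfin,
    ENNReal.ofReal_add (by positivity) (by norm_num), ENNReal.ofReal_mul (by norm_num)]
  simp
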